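/- Let $p\in(1,\infty)$, $d_{\mathrm f}\ge 1$ and $\beta>0$, and put $\zeta=d_{\mathrm f}-\beta$. Let $G=(V,E)$ be a connected simple undirected graph of bounded degree, with graph distance $d$, open balls $B(x,R)=\{y\in V: d(x,y)<R\}$, and $\operatorname{diam}(S)=\sup_{x,y\in S}d(x,y)$, $\operatorname{diam}(G)=\operatorname{diam}(V)\in[0,\infty]$. Notation. A path is a finite sequence $\theta=[x_0,\dots,x_n]$, $n\ge1$, of vertices with $\{x_i,x_{i+1}\}\in E$ for all $i<n$; it is also regarded as the set of its vertices. For a family $\Theta$ of paths, $$\mathrm{Mod}_p(\Theta)=\inf\Big\{\sum_{v\in V}\rho(v)^p \;:\; \rho\colon V\to[0,\infty),\ \sum_{v\in\theta}\rho(v)\ge1\text{ for all }\theta\in\Theta\Big\}.$$ $\mathsf{Path}(S,T)$ is the family of the paths with $x_0\in S$ and $x_n\in T$. For $S,T\subseteq V$, $$\mathrm{cap}_p(S,T)=\inf\Big\{\sum_{\{x,y\}\in E}|f(x)-f(y)|^p \;:\; f\colon V\to\mathbb R,\ f|_S=0,\ f|_T=1\Big\}.$$ A function $h\colon V\to\mathbb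 R$ is $p$-harmonic on $S\subseteq V$ if $\sum_{y:\{x,y\}\in E}\operatorname{sgn}(h(y)-h(x))\,|h(y)-h(x)|^{p-1}=0$ for all $x\in S$. Assume: 1. ($d_{\mathrm f}$-Ahlfors regularity.) There is $C_{\mathrm{AR}}\ge1$ with $C_{\mathrm{AR}}^{-1}r^{d_{\mathrm f}}\le \#B(x,r)\le C_{\mathrm{AR}}\,r^{d_{\mathrm f}}$ for all $x\in V$ and $r\in(1,\operatorname{diam}(G))$. 2. ($\mathrm{BCL}_p^{\mathrm{low}}(\zeta)$.) $1-p\le\zeta<1$, and there is $A\ge1$ and, for every $\kappa>0$, there are $c(\kappa)>0$ and $L(\kappa)>0$ such that $$\mathrm{Mod}_p\big(\{\theta\in\mathsf{Path}(B_1,B_2): \operatorname{diam}(\theta)\le L(\kappa)R\}\big)\ge c(\kappa)R^{\zeta}$$ whenever $R\in[1,\operatorname{diam}(G)/A)$ and $B_1,B_2$ are balls of radius $R$ at distance at most $\kappa R$ from each other. 3. (Capacity upper bound of order $\beta$.) There are $C_{\mathrm{cap}}>0$ and $A_{\mathrm{cap}}\ge1$ with $$\mathrm{cap}_p\big(B(x,R),V\setminus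 B(x,2R)\big)\le C_{\mathrm{cap}}\frac{\#B(x,R)}{R^{\beta}}$$ for all $x\in V$ and $R\in[1,\operatorname{diam}(G)/A_{\mathrm{cap}})$. Then there are constants $\delta_{\mathrm H}\in(0,1)$ and $C_{\mathrm H}\ge1$, depending only on $p,d_{\mathrm f},\beta,C_{\mathrm{AR}},A,c(\cdot),L(\cdot),C_{\mathrm{cap}},A_{\mathrm{cap}}$ (and not otherwise on $G$), such that for all $x\in V$ and $R\ge1$ with $B(x,R)\ne V$ and every $h\colon V\to[0,\infty)$ that is $p$-harmonic on $B(x,R)$, $$\max_{B(x,\delta_{\mathrm H}R)}h\;\le\; C_{\mathrm H}\min_{B(x,\delta_{\mathrm H}R)}h .$$ -/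

import Mathlib

open scoped ENNReal NNReal

universe u

namespace GraphEHI

noncomputable section

/-! Throughout, `G` is a simple graph with its graph distance `G.dist`, which is used only for
connected `G`. Diameters, distances of sets, moduli, energies and capacities take values in
`[0, ∞]`. -/

/-- The open ball `B(x, R) = {y | d(x, y) < R}` for the graph distance. -/
def ball {V : Type u} (G : SimpleGraph V) (x : V) (R : ℝ) : Set V :=
  {y | (G.dist x y : ℝ) < R}

/-- Balls of a locally finite connected graph are finite sets, so that `Set.ncard` below is the
true number of elements. -/
theorem ball_finite {V : Type u} (G : SimpleGraph V) [G.LocallyFinite] (hG : G.Connected)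
    (x : V) (R : ℝ) : (ball G x R).Finite := by
  have key : ∀ n : ℕ, {y | G.dist x y ≤ n}.Finite := by
    intro n
    induction n with
    | zero =>
      refine (Set.finite_singleton x).subset ?_
      intro y hy
      have h0 : G.dist x y = 0 := Nat.le_zero.mp hy
      exact ((hG.dist_eq_zero_iff).mp h0).symm
    | succ n ih =>
      have hfin : (⋃ z ∈ {y | G.dist x y ≤ n}, G.neighborSet z).Finite :=
        ih.biUnion fun z _ => Set.toFinite _
      refine (hfin.union ih).subset ?_
      intro y hy
      obtain ⟨w, hw⟩ := hG.exists_walk_length_eq_dist y x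
      cases w with
      | nil => right; simp
      | cons hadj w' =>
        left
        rename_i z
        refine Set.mem_biUnion (x := z) ?_ hadj.symm
        have h1 : G.dist z x ≤ w'.length := SimpleGraph.dist_le w'
        have h2 : w'.length + 1 = G.dist y x := by simpa using hw
        have h3 : G.dist y x = G.dist x y := SimpleGraph.dist_comm
        have h4 : G.dist z x = G.dist x z := SimpleGraph.dist_comm
        have hy' : G.dist x y ≤ n + 1 := hy
        change G.dist x z ≤ n
        omega
  refine (key ⌈R⌉₊).subset ?_
  intro y hy
  have hy' : (G.dist x y : ℝ) < R := hy
  have : (G.dist x y : ℝ) ≤ (⌈R⌉₊ : ℝ) := hy'.le.trans (Nat.le_ceil R)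
  exact_mod_cast this

/-- The diameter `sup_{x, y ∈ S} d(x, y) ∈ [0, ∞]` of a set of vertices. -/
def setDiam {V : Type u} (G : SimpleGraph V) (S : Set V) : ℝ≥0∞ :=
  ⨆ x ∈ S, ⨆ y ∈ S, (G.dist x y : ℝ≥0∞)

/-- The diameter of the graph. -/
def graphDiam {V : Type u} (G : SimpleGraph V) : ℝ≥0∞ := setDiam G Set.univ

/-- The distance `inf_{x ∈ S, y ∈ T} d(x, y)` between two sets of vertices. -/
def setDist {V : Type u} (G : SimpleGraph V) (S T : Set V) : ℝ≥0∞ :=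
  ⨅ x ∈ S, ⨅ y ∈ T, (G.dist x y : ℝ≥0∞)

/-! ### Paths and combinatorial modulus -/

/-- A finite path `[x₀, …, xₙ]`, `n ≥ 1`, with consecutive vertices adjacent. It need not be
simple. -/
structure FinPath {V : Type u} (G : SimpleGraph V) where
  /-- the first vertex -/
  first : V
  /-- the last vertex -/
  last : V
  /-- the underlying walk -/
  walk : G.Walk first last
  /-- a path has at least one edge -/
  length_pos : 0 < walk.length

/-- The set of vertices of a path. -/
def FinPath.verts {V : Type u} {G : SimpleGraph V} (θ : FinPath G) : Set V :=
  {v | v ∈ θ.walk.support}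

open Classical in
/-- The `ρ`-length `L_ρ(θ) = ∑_{v ∈ θ} ρ(v)`, the path being regarded as a set of vertices. -/
def rhoLength {V : Type u} {G : SimpleGraph V} (ρ : V → ℝ≥0) (θ : FinPath G) : ℝ≥0 :=
  ∑ v ∈ θ.walk.support.toFinset, ρ v

/-- Admissible functions for a path family `Θ`: those with `inf_{θ ∈ Θ} L_ρ(θ) ≥ 1`. -/
def Adm {V : Type u} {G : SimpleGraph V} (Θ : Set (FinPath G)) : Set (V → ℝ≥0) :=
  {ρ | 1 ≤ ⨅ θ ∈ Θ, (rhoLength ρ θ : ℝ≥0∞)}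

/-- The combinatorial `p`-modulus of a path family. -/
def modulus {V : Type u} {G : SimpleGraph V} (p : ℝ) (Θ : Set (FinPath G)) : ℝ≥0∞ :=
  ⨅ ρ ∈ Adm Θ, ∑' v, (ρ v : ℝ≥0∞) ^ p

/-- The family of all paths from `S` to `T`. -/
def pathsBetween {V : Type u} (G : SimpleGraph V) (S T : Set V) : Set (FinPath G) :=
  {θ | θ.first ∈ S ∧ θ.last ∈ T}

/-! ### Energy, capacity and harmonic functions -/

/-- The contribution `|f(x) - f(y)|^p` of an (unordered) edge `{x, y}` to the `p`-energy. -/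
def edgeEnergy {V : Type u} (p : ℝ) (f : V → ℝ) : Sym2 V → ℝ≥0∞ :=
  Sym2.lift ⟨fun x y => ENNReal.ofReal (|f x - f y| ^ p), fun x y => by simp only [abs_sub_comm]⟩

/-- The `p`-energy `∑_{{x,y} ∈ E} |f(x) - f(y)|^p`. -/
def energy {V : Type u} (G : SimpleGraph V) (p : ℝ) (f : V → ℝ) : ℝ≥0∞ :=
  ∑' e : G.edgeSet, edgeEnergy p f (e : Sym2 V)

/-- The `p`-capacity between `S` and `T`: the infimum of the `p`-energies of the functions that
are `0` on `S` and `1` on `T`. -/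
def capacity {V : Type u} (G : SimpleGraph V) (p : ℝ) (S T : Set V) : ℝ≥0∞ :=
  ⨅ f ∈ {f : V → ℝ | (∀ x ∈ S, f x = 0) ∧ (∀ x ∈ T, f x = 1)}, energy G p f

/-- The `p`-Laplacian
`Δ_p f(x) = deg(x)⁻¹ ∑_{y ∼ x} sgn(f(y) - f(x)) |f(y) - f(x)|^(p-1)`. -/
def pLaplacian {V : Type u} (G : SimpleGraph V) [G.LocallyFinite] (p : ℝ) (f : V → ℝ) (x : V) :
    ℝ :=
  (1 / (G.degree x : ℝ)) *
    ∑ y ∈ G.neighborFinset x, Real.sign (f y - f x) * |f y - f x| ^ (p - 1)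

/-- `f` is `p`-harmonic in `S`. -/
def IsPHarmonicOn {V : Type u} (G : SimpleGraph V) [G.LocallyFinite] (p : ℝ) (f : V → ℝ)
    (S : Set V) : Prop :=
  ∀ x ∈ S, pLaplacian G p f x = 0

/-! ### The conditions on the graph, with their constants -/

/-- `df`-Ahlfors regularity (for the counting measure) with constant `C ≥ 1`. -/
def AhlforsRegularWith {V : Type u} (G : SimpleGraph V) (df C : ℝ) : Prop :=
  1 ≤ C ∧
  ∀ (x : V) (r : ℝ), 1 < r → ENNReal.ofReal r < graphDiam G →
    C⁻¹ * r ^ df ≤ ((ball G x r).ncard : ℝ) ∧ ((ball G x r).ncard : ℝ) ≤ C * r ^ df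

/-- The `p`-combinatorial ball Loewner condition with exponent `ζ`, with constant `A ≥ 1` and
constants `c κ > 0`, `L κ > 0` for each `κ > 0`. -/
def BallLoewnerWith {V : Type u} (G : SimpleGraph V) (p ζ A : ℝ) (c L : ℝ → ℝ) : Prop :=
  1 ≤ A ∧
  ∀ κ : ℝ, 0 < κ → 0 < c κ ∧ 0 < L κ ∧
    ∀ (R : ℝ) (x₁ x₂ : V), 1 ≤ R → ENNReal.ofReal R < graphDiam G / ENNReal.ofReal A →
      setDist G (ball G x₁ R) (ball G x₂ R) ≤ ENNReal.ofReal (κ * R) →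
      ENNReal.ofReal (c κ * R ^ ζ) ≤
        modulus p {θ ∈ pathsBetween G (ball G x₁ R) (ball G x₂ R) |
          setDiam G θ.verts ≤ ENNReal.ofReal (L κ * R)}

/-- The low-dimensional ball Loewner condition: the ball Loewner condition with
`1 - p ≤ ζ < 1`. -/
def LowBallLoewnerWith {V : Type u} (G : SimpleGraph V) (p ζ A : ℝ) (c L : ℝ → ℝ) : Prop :=
  BallLoewnerWith G p ζ A c L ∧ 1 - p ≤ ζ ∧ ζ < 1

/-- The `p`-capacity upper bound of order `β`, with constants `C > 0` and `A ≥ 1`. -/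
def CapacityUpperWith {V : Type u} (G : SimpleGraph V) (p β C A : ℝ) : Prop :=
  0 < C ∧ 1 ≤ A ∧
  ∀ (x : V) (R : ℝ), 1 ≤ R → ENNReal.ofReal R < graphDiam G / ENNReal.ofReal A →
    capacity G p (ball G x R) (ball G x (2 * R))ᶜ ≤
      ENNReal.ofReal (C * (((ball G x R).ncard : ℝ) / R ^ β))

end

end GraphEHI

namespace GraphEHI

/-! ### A pointwise inequality for the logarithm -/

/-! After adding a small constant, `h` is positive, and it suffices to bound the oscillation of `f =
log h` on a small concentric ball by a constant independent of `h` and `R`. Write `ζ = df - β`.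
Three properties of `f` are used.

(1) Small energy. Testing the equation with `φ ^ p * h ^ (1 - p)`, where `φ` is a cutoff, bounds the
energy of `f` by that of `φ` (`log_caccioppoli`). The capacity bound and the upper volume bound turn
this into `O(S ^ ζ)` on a ball of radius comparable to `S` (`log_energy_le`). (2) Extrema propagate.
Every sphere in the harmonic region carries points where `f` is at least, and points where it is at
most, any given value taken inside (`IsPHarmonicOn.exists_sphere_ge`). This is where `B(x, R) ≠ V`
enters. (3) Separation costs energy. If `f` differs by at least `τ` between two comparable balls of
radius `r`, the Loewner condition forces energy at least a constant times `r ^ ζ * τ ^ p` nearby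
(`energy_ge_of_modulus`).

`exists_osc_bound` combines them over scales `a ^ k * S` with `a = 1 / (9 * N)`. Given `u`, `v` in a
ball of scale `k`, (2) supplies `N` disjoint balls of scale `k + 1` around points where `f ≥ f u`,
and as many where `f ≤ f v`; in each family one ball carries at most `1 / N` of the energy. Relative
to `s ^ ζ`, energy thus drops by the factor `Θ = a ^ (-ζ) / N` per scale, and since `ζ < 1` a large
`N` makes `θ = Θ ^ (1 / p)` at most `1 / 4`. By (3), `f u - f v` is at most `O(θ ^ k)` plus the
oscillations on the two smaller balls. The bound `D * θ ^ k` therefore passes from scale `k + 1` to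
scale `k`. The recursion ends because small balls in a graph are single points. -/

theorem exp_sub_one_ge {l : ℝ} (hl : 0 ≤ l) : l * Real.exp (l / 2) ≤ Real.exp l - 1 := by
  have h1 : l / 2 ≤ Real.sinh (l / 2) := Real.self_le_sinh_iff.2 (by linarith)
  rw [Real.sinh_eq] at h1
  have h2 : Real.exp l = Real.exp (l / 2) * Real.exp (l / 2) := by
    rw [← Real.exp_add]; congr 1; ring
  have h3 : Real.exp (l / 2) * Real.exp (-(l / 2)) = 1 := by
    rw [← Real.exp_add]; simp
  have h4 := Real.exp_pos (l / 2)
  nlinarith [mul_le_mul_of_nonneg_left h1 h4.le]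

/-- With `l = log t` and `q = (p - 1) / 2`, multiply `(t - 1) ^ (p - 1) ≥ l ^ (p - 1) * exp (q * l)`
by `exp (q * l) * (1 - exp (-(q * l))) ≥ q * l`; the exponential factors cancel. -/
theorem log_rpow_le {p t : ℝ} (hp : 1 < p) (ht : 1 ≤ t) :
    (p - 1) / 2 * Real.log t ^ p ≤ (t - 1) ^ (p - 1) * (1 - t ^ (-((p - 1) / 2))) := by
  have ht0 : 0 < t := by linarith
  set l := Real.log t with hl
  have hl0 : 0 ≤ l := Real.log_nonneg ht
  have htl : t = Real.exp l := (Real.exp_log ht0).symm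
  set q := (p - 1) / 2 with hq
  have hq0 : 0 < q := by rw [hq]; linarith
  have hpow : t ^ (-q) = Real.exp (-(q * l)) := by
    rw [htl, ← Real.exp_mul]; congr 1; ring
  have h1 : l ^ (p - 1) * Real.exp (q * l) ≤ (t - 1) ^ (p - 1) := by
    have : (l * Real.exp (l / 2)) ^ (p - 1) ≤ (t - 1) ^ (p - 1) := by
      apply Real.rpow_le_rpow (by positivity) _ (by linarith)
      rw [htl]; exact exp_sub_one_ge hl0
    rwa [Real.mul_rpow hl0 (Real.exp_pos _).le, ← Real.exp_mul,
      show l / 2 * (p - 1) = q * l by rw [hq]; ring] at this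
  have h2 : 0 ≤ 1 - t ^ (-q) := by
    rw [hpow, sub_nonneg, Real.exp_le_one_iff]; nlinarith
  have h3 : q * l ≤ Real.exp (q * l) * (1 - t ^ (-q)) := by
    rw [hpow, mul_sub, ← Real.exp_add]
    have := Real.add_one_le_exp (q * l)
    simp; linarith
  rcases hl0.eq_or_lt with h0 | h0
  · rw [← h0, Real.zero_rpow (by linarith), mul_zero]
    exact mul_nonneg (Real.rpow_nonneg (by linarith) _) h2
  have hlp : l ^ p = l ^ (p - 1) * l := by
    rw [← Real.rpow_add_one h0.ne']; simp
  calc q * l ^ p = l ^ (p - 1) * (q * l) := by rw [hlp]; ring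
    _ ≤ l ^ (p - 1) * (Real.exp (q * l) * (1 - t ^ (-q))) :=
        mul_le_mul_of_nonneg_left h3 (Real.rpow_nonneg hl0 _)
    _ = l ^ (p - 1) * Real.exp (q * l) * (1 - t ^ (-q)) := by ring
    _ ≤ _ := mul_le_mul_of_nonneg_right h1 h2

/-- Convexity of `z ^ p` at `A / w` and `d / (1 - w)` with weights `w` and `1 - w`. -/
theorem rpow_add_le {p A d w : ℝ} (hp : 1 < p) (hA : 0 ≤ A) (hd : 0 ≤ d) (hw : 0 < w)
    (hw1 : w < 1) : (A + d) ^ p ≤ w ^ (1 - p) * A ^ p + (1 - w) ^ (1 - p) * d ^ p := by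
  have hc := (convexOn_rpow hp.le).2 (x := A / w) (by simp; positivity) (y := d / (1 - w))
    (by simp; exact div_nonneg hd (by linarith)) hw.le (sub_nonneg.2 hw1.le) (by ring)
  have hw' : 0 < 1 - w := by linarith
  simp only [smul_eq_mul] at hc
  rw [mul_div_cancel₀ _ hw.ne', mul_div_cancel₀ _ hw'.ne', Real.div_rpow hA hw.le,
    Real.div_rpow hd hw'.le] at hc
  have e : ∀ z : ℝ, 0 < z → z ^ (1 - p) = z / z ^ p := fun z hz => by
    rw [Real.rpow_sub hz, Real.rpow_one]
  rw [e w hw, e _ hw']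
  calc _ ≤ _ := hc
    _ = _ := by ring

theorem caccioppoli_ratio {p t A B : ℝ} (hp : 1 < p) (ht : 1 < t) (hA : 0 ≤ A) (hB : 0 ≤ B) :
    (t - 1) ^ (p - 1) * (B ^ p * t ^ (1 - p) - A ^ p) ≤
      2 ^ (p - 1) * |B - A| ^ p - (p - 1) / 2 * (A ^ p * Real.log t ^ p) := by
  have ht0 : 0 < t := by linarith
  have hl := mul_le_mul_of_nonneg_left (log_rpow_le hp ht.le) (Real.rpow_nonneg hA p)
  have hu : 0 ≤ (t - 1) ^ (p - 1) := Real.rpow_nonneg (by linarith) _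
  -- This weight balances both terms: the coefficient of `A ^ p` becomes the one in `log_rpow_le`,
  -- and `t - 1 = (1 + w) * (1 - w) * t` bounds that of `|B - A| ^ p` by `2 ^ (p - 1)`, uniformly in
  -- `t`.
  set w := t ^ (-(1 / 2) : ℝ) with hw
  have hw0 : 0 < w := Real.rpow_pos_of_pos ht0 _
  have hw1 : w < 1 := Real.rpow_lt_one_of_one_lt_of_neg ht (by norm_num)
  have hww : w * w = 1 / t := by
    rw [hw, ← Real.rpow_add ht0]; norm_num [Real.rpow_neg_one]
  have hB' : B ^ p ≤ w ^ (1 - p) * A ^ p + (1 - w) ^ (1 - p) * |B - A| ^ p := by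
    refine le_trans ?_ (rpow_add_le hp hA (abs_nonneg (B - A)) hw0 hw1)
    exact Real.rpow_le_rpow hB (by linarith [le_abs_self (B - A)]) (by linarith)
  have e1 : w ^ (1 - p) * t ^ (1 - p) = t ^ (-((p - 1) / 2)) := by
    rw [hw, ← Real.rpow_mul ht0.le, ← Real.rpow_add ht0]; congr 1; ring
  have e2 : (t - 1) ^ (p - 1) * ((1 - w) ^ (1 - p) * t ^ (1 - p)) = (1 + w) ^ (p - 1) := by
    have hp1 : 1 - p = -(p - 1) := by ring
    have h1w : 0 < 1 - w := by linarith
    rw [hp1, Real.rpow_neg h1w.le, Real.rpow_neg ht0.le]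
    have : t - 1 = (1 + w) * ((1 - w) * t) := by
      have : w * w * t = 1 := by rw [hww]; field_simp
      linear_combination this
    rw [this, Real.mul_rpow (by linarith) (by positivity), Real.mul_rpow h1w.le ht0.le]
    have h1 := Real.rpow_pos_of_pos h1w (p - 1)
    have h2 := Real.rpow_pos_of_pos ht0 (p - 1)
    field_simp
  have e3 : (1 + w) ^ (p - 1) ≤ 2 ^ (p - 1) :=
    Real.rpow_le_rpow (by linarith) (by linarith) (by linarith)
  have ht1 : 0 ≤ t ^ (1 - p) := Real.rpow_nonneg ht0.le _
  calc _ ≤ (t - 1) ^ (p - 1) *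
        ((w ^ (1 - p) * A ^ p + (1 - w) ^ (1 - p) * |B - A| ^ p) * t ^ (1 - p) - A ^ p) := by
        gcongr
    _ = (t - 1) ^ (p - 1) * ((1 - w) ^ (1 - p) * t ^ (1 - p)) * |B - A| ^ p
        - A ^ p * ((t - 1) ^ (p - 1) * (1 - w ^ (1 - p) * t ^ (1 - p))) := by ring
    _ ≤ 2 ^ (p - 1) * |B - A| ^ p - (p - 1) / 2 * (A ^ p * Real.log t ^ p) := by
        rw [e2, e1]
        have := mul_le_mul_of_nonneg_right e3 (Real.rpow_nonneg (abs_nonneg (B - A)) p)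
        linarith

theorem caccioppoli_of_lt {p a b A B : ℝ} (hp : 1 < p) (ha : 0 < a) (hab : a < b)
    (hA : 0 ≤ A) (hB : 0 ≤ B) :
    (b - a) ^ (p - 1) * (B ^ p * b ^ (1 - p) - A ^ p * a ^ (1 - p)) ≤
      2 ^ (p - 1) * |B - A| ^ p -
        (p - 1) / 2 * (min A B ^ p * |Real.log b - Real.log a| ^ p) := by
  have hb : 0 < b := ha.trans hab
  have ht : 1 < b / a := (one_lt_div ha).2 hab
  have key := caccioppoli_ratio hp ht hA hB
  have e0 : Real.log b - Real.log a = Real.log (b / a) := (Real.log_div hb.ne' ha.ne').symm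
  have e1 : (b / a - 1) ^ (p - 1) * (B ^ p * (b / a) ^ (1 - p) - A ^ p) =
      (b - a) ^ (p - 1) * (B ^ p * b ^ (1 - p) - A ^ p * a ^ (1 - p)) := by
    have hp1 : 1 - p = -(p - 1) := by ring
    have h1 := Real.rpow_pos_of_pos ha (p - 1)
    have h2 := Real.rpow_pos_of_pos hb (p - 1)
    rw [show b / a - 1 = (b - a) / a by field_simp, hp1, Real.rpow_neg (by positivity),
      Real.rpow_neg hb.le, Real.rpow_neg ha.le, Real.div_rpow (by linarith) ha.le,
      Real.div_rpow hb.le ha.le]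
    field_simp
  rw [e1] at key
  refine key.trans ?_
  have hl : 0 ≤ Real.log (b / a) := Real.log_nonneg ht.le
  rw [e0, abs_of_nonneg hl]
  have hm : min A B ^ p ≤ A ^ p :=
    Real.rpow_le_rpow (le_min hA hB) (min_le_left _ _) (by linarith)
  have := mul_le_mul_of_nonneg_right hm (Real.rpow_nonneg hl p)
  have hq : 0 ≤ (p - 1) / 2 := by linarith
  linarith [mul_le_mul_of_nonneg_left this hq]

/-- The pointwise estimate behind the logarithmic Caccioppoli inequality. -/
theorem caccioppoli_pointwise {p a b A B : ℝ} (hp : 1 < p) (ha : 0 < a) (hb : 0 < b)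
    (hA : 0 ≤ A) (hB : 0 ≤ B) :
    Real.sign (b - a) * |b - a| ^ (p - 1) * (B ^ p * b ^ (1 - p) - A ^ p * a ^ (1 - p)) ≤
      2 ^ (p - 1) * |A - B| ^ p -
        (p - 1) / 2 * (min A B ^ p * |Real.log a - Real.log b| ^ p) := by
  rcases lt_trichotomy a b with h | h | h
  · have := caccioppoli_of_lt hp ha h hA hB
    rw [Real.sign_of_pos (sub_pos.2 h), abs_of_pos (sub_pos.2 h), one_mul, abs_sub_comm A,
      abs_sub_comm (Real.log a)]
    exact this
  · subst h
    have h1 : (0 : ℝ) ^ p = 0 := Real.zero_rpow (by linarith)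
    simp only [sub_self, Real.sign_zero, abs_zero, h1]
    simp only [zero_mul, mul_zero, sub_zero]
    positivity
  · have := caccioppoli_of_lt hp hb h hB hA
    rw [Real.sign_of_neg (sub_neg.2 h), abs_sub_comm b a, abs_of_pos (sub_pos.2 h), min_comm]
    linarith

/-! ### Finite balls and local energies -/

/-- The ball `B(x, r)` as a finite set. -/
noncomputable def ballFinset {V : Type u} {G : SimpleGraph V} [G.LocallyFinite]
    (hG : G.Connected) (x : V) (r : ℝ) : Finset V :=
  (ball_finite G hG x r).toFinset

open Classical in
/-- The energy of `f` inside the finite set `T`, each edge being counted twice. -/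
noncomputable def localEnergy {V : Type u} (G : SimpleGraph V) (p : ℝ) (f : V → ℝ)
    (T : Finset V) : ℝ :=
  ∑ u ∈ T, ∑ v ∈ T, if G.Adj u v then |f u - f v| ^ p else 0

section
variable {V : Type u} {G : SimpleGraph V}

theorem mem_ballFinset [G.LocallyFinite] (hG : G.Connected) {x y : V} {r : ℝ} :
    y ∈ ballFinset hG x r ↔ (G.dist x y : ℝ) < r := by
  simp [ballFinset, ball]

theorem dist_triangle_real (hG : G.Connected) (x y z : V) :
    (G.dist x z : ℝ) ≤ G.dist x y + G.dist y z := by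
  exact_mod_cast hG.dist_triangle

theorem dist_adj_le (hG : G.Connected) {y z : V} (h : G.Adj y z) (x : V) :
    (G.dist x z : ℝ) ≤ G.dist x y + 1 := by
  have h1 := dist_triangle_real hG x y z
  rw [SimpleGraph.dist_eq_one_iff_adj.2 h] at h1
  exact_mod_cast h1

theorem ballFinset_subset [G.LocallyFinite] (hG : G.Connected) {x y : V} {r s : ℝ}
    (h : (G.dist y x : ℝ) + r ≤ s) : ballFinset hG x r ⊆ ballFinset hG y s := by
  intro z hz
  rw [mem_ballFinset] at *
  linarith [dist_triangle_real hG y x z]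

theorem ballFinset_disjoint [G.LocallyFinite] (hG : G.Connected) {x y : V} {r s : ℝ}
    (h : r + s ≤ G.dist x y) : Disjoint (ballFinset hG x r) (ballFinset hG y s) := by
  rw [Finset.disjoint_left]
  intro z hz hz'
  rw [mem_ballFinset] at *
  have := dist_triangle_real hG x z y
  rw [SimpleGraph.dist_comm (u := y)] at hz'
  linarith

variable {p : ℝ} {f : V → ℝ}

open Classical in
theorem edge_term_nonneg (u v : V) :
    0 ≤ if G.Adj u v then |f u - f v| ^ p else 0 := by
  split_ifs <;> positivity

theorem localEnergy_nonneg (T : Finset V) : 0 ≤ localEnergy G p f T :=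
  Finset.sum_nonneg fun u _ => Finset.sum_nonneg fun v _ => edge_term_nonneg u v

theorem localEnergy_mono {S T : Finset V} (h : S ⊆ T) :
    localEnergy G p f S ≤ localEnergy G p f T := by
  refine (Finset.sum_le_sum fun u _ => Finset.sum_le_sum_of_subset_of_nonneg h
    fun v _ _ => edge_term_nonneg u v).trans ?_
  exact Finset.sum_le_sum_of_subset_of_nonneg h fun u _ _ =>
    Finset.sum_nonneg fun v _ => edge_term_nonneg u v

theorem sum_localEnergy_le {ι : Type*} (I : Finset ι) (S : ι → Finset V) (T : Finset V)
    (hd : (I : Set ι).PairwiseDisjoint S) (hS : ∀ i ∈ I, S i ⊆ T) :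
    ∑ i ∈ I, localEnergy G p f (S i) ≤ localEnergy G p f T := by
  classical
  calc ∑ i ∈ I, localEnergy G p f (S i)
      ≤ ∑ i ∈ I, ∑ u ∈ S i, ∑ v ∈ T, (if G.Adj u v then |f u - f v| ^ p else 0) := by
        refine Finset.sum_le_sum fun i hi => ?_
        unfold localEnergy
        refine Finset.sum_le_sum fun u _ => ?_
        convert Finset.sum_le_sum_of_subset_of_nonneg (hS i hi)
          fun v _ _ => edge_term_nonneg (G := G) (p := p) (f := f) u v
    _ = ∑ u ∈ I.biUnion S, ∑ v ∈ T, (if G.Adj u v then |f u - f v| ^ p else 0) :=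
        (Finset.sum_biUnion hd).symm
    _ ≤ _ := by
        unfold localEnergy
        convert Finset.sum_le_sum_of_subset_of_nonneg (Finset.biUnion_subset.2 hS)
          fun u _ _ => Finset.sum_nonneg fun v _ =>
            edge_term_nonneg (G := G) (p := p) (f := f) u v

theorem abs_sub_rpow_le_localEnergy {T : Finset V} {u v : V} (hu : u ∈ T) (hv : v ∈ T)
    (h : G.Adj u v) : |f u - f v| ^ p ≤ localEnergy G p f T := by
  classical
  have h1 : |f u - f v| ^ p ≤ ∑ w ∈ T, if G.Adj u w then |f u - f w| ^ p else 0 := by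
    refine le_trans (by simp [h]) (Finset.single_le_sum
      (f := fun w => if G.Adj u w then |f u - f w| ^ p else 0)
      (fun w _ => edge_term_nonneg u w) hv)
  refine h1.trans ?_
  unfold localEnergy
  convert Finset.single_le_sum
    (f := fun u => ∑ w ∈ T, if G.Adj u w then |f u - f w| ^ p else 0)
    (fun w _ => Finset.sum_nonneg fun v _ => edge_term_nonneg w v) hu

/-- Oscillation along a geodesic. -/
theorem abs_sub_le_dist_mul [G.LocallyFinite] (hG : G.Connected) (hp : 0 < p) {y : V} {r : ℝ}
    (u : V) (hu : (G.dist y u : ℝ) < r) :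
    |f u - f y| ≤ G.dist y u * localEnergy G p f (ballFinset hG y r) ^ (1 / p) := by
  obtain ⟨n, hn⟩ : ∃ n, G.dist y u = n := ⟨_, rfl⟩
  induction n generalizing u with
  | zero =>
    obtain rfl := (hG.dist_eq_zero_iff).1 hn
    simp
  | succ n ih =>
    obtain ⟨w, hw⟩ := hG.exists_walk_length_eq_dist u y
    cases w with
    | nil => simp at hn
    | @cons _ z _ hadj w' =>
      have h1 : G.dist z y ≤ w'.length := SimpleGraph.dist_le w'
      have h2 : w'.length + 1 = G.dist u y := by simpa using hw
      have h3 : G.dist u y = G.dist y u := SimpleGraph.dist_comm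
      have h4 : G.dist z y = G.dist y z := SimpleGraph.dist_comm
      have h5 := dist_adj_le hG hadj.symm y
      have h6 : G.dist y z = n := by
        have : G.dist y u ≤ G.dist y z + 1 := by exact_mod_cast h5
        omega
      have hz : (G.dist y z : ℝ) < r := by
        rw [h6]; rw [hn] at hu; push_cast at hu; linarith
      have h7 := ih z hz h6
      have h8 : |f u - f z| ≤ localEnergy G p f (ballFinset hG y r) ^ (1 / p) := by
        have := abs_sub_rpow_le_localEnergy (G := G) (p := p) (f := f)
          ((mem_ballFinset hG).2 hu) ((mem_ballFinset hG).2 hz) hadj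
        have h9 := Real.rpow_le_rpow (by positivity) this (one_div_pos.2 hp).le
        rwa [← Real.rpow_mul (abs_nonneg _), mul_one_div_cancel hp.ne', Real.rpow_one] at h9
      rw [hn]
      rw [h6] at h7
      push_cast
      calc |f u - f y| ≤ |f u - f z| + |f z - f y| := abs_sub_le _ _ _
        _ ≤ _ := by linarith

/-! ### The maximum principle -/

theorem IsPHarmonicOn.sum_eq_zero [G.LocallyFinite] {S : Set V} (h : IsPHarmonicOn G p f S)
    {x : V} (hx : x ∈ S) :
    ∑ y ∈ G.neighborFinset x, Real.sign (f y - f x) * |f y - f x| ^ (p - 1) = 0 := by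
  have h1 := h x hx
  unfold pLaplacian at h1
  rcases mul_eq_zero.1 h1 with h0 | h0
  -- The normalising factor `1 / deg` is zero at an isolated vertex by convention; the sum is then
  -- empty.
  · have : G.degree x = 0 := by simpa using h0
    rw [← SimpleGraph.card_neighborFinset_eq_degree, Finset.card_eq_zero] at this
    rw [this]; simp
  · exact h0

theorem IsPHarmonicOn.neg [G.LocallyFinite] {S : Set V} (h : IsPHarmonicOn G p f S) :
    IsPHarmonicOn G p (fun v => -f v) S := by
  intro x hx
  have h1 := h.sum_eq_zero hx
  have h2 : ∀ y, Real.sign (-f y - -f x) * |-f y - -f x| ^ (p - 1) =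
      -(Real.sign (f y - f x) * |f y - f x| ^ (p - 1)) := by
    intro y
    rw [show -f y - -f x = -(f y - f x) by ring, Real.sign_neg, abs_neg]; ring
  simp only [pLaplacian, h2, Finset.sum_neg_distrib, h1, neg_zero, mul_zero]

theorem IsPHarmonicOn.add_const [G.LocallyFinite] {S : Set V} (h : IsPHarmonicOn G p f S)
    (t : ℝ) : IsPHarmonicOn G p (fun v => f v + t) S := by
  intro x hx
  have := h x hx
  simpa [pLaplacian] using this

/-- At a local maximum all terms of the `p`-Laplacian are nonpositive, so a zero sum makes each of
them vanish. -/
theorem IsPHarmonicOn.eq_of_forall_le [G.LocallyFinite] {S : Set V}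
    (h : IsPHarmonicOn G p f S) {x : V} (hx : x ∈ S) (hle : ∀ y, G.Adj x y → f y ≤ f x)
    {y : V} (hy : G.Adj x y) : f y = f x := by
  have h1 := h.sum_eq_zero hx
  have h2 : ∀ z ∈ G.neighborFinset x, Real.sign (f z - f x) * |f z - f x| ^ (p - 1) ≤ 0 := by
    intro z hz
    have hz' := hle z (by simpa using hz)
    refine mul_nonpos_of_nonpos_of_nonneg ?_ (by positivity)
    rcases hz'.eq_or_lt with h0 | h0
    · simp [h0]
    · rw [Real.sign_of_neg (by linarith)]; norm_num
  have h3 := (Finset.sum_eq_zero_iff_of_nonpos h2).1 h1 y (by simpa using hy)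
  by_contra hne
  have h4 : f y - f x < 0 := sub_neg.2 (lt_of_le_of_ne (hle y hy) hne)
  have h5 : 0 < |f y - f x| ^ (p - 1) := Real.rpow_pos_of_pos (abs_pos.2 h4.ne) _
  rw [Real.sign_of_neg h4] at h3
  linarith

/-- The maximum over a closed ball is attained on the sphere. -/
theorem IsPHarmonicOn.exists_sphere_ge [G.LocallyFinite] (hG : G.Connected) {S : Set V}
    (h : IsPHarmonicOn G p f S) (y : V) (n : ℕ) (hS : ∀ v, G.dist y v < n → v ∈ S)
    (hne : S ≠ Set.univ) {z : V} (hz : G.dist y z ≤ n) :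
    ∃ e, G.dist y e = n ∧ f z ≤ f e := by
  obtain ⟨w, hw, hmax⟩ := Finset.exists_max_image (ballFinset hG y (n + 1)) f
    ⟨y, by rw [mem_ballFinset]; simp; positivity⟩
  have hmem : ∀ v, v ∈ ballFinset hG y (n + 1) ↔ G.dist y v ≤ n := by
    intro v; rw [mem_ballFinset, ← Nat.lt_add_one_iff]; exact_mod_cast Iff.rfl
  by_contra! hcon
  have hfz := hmax z ((hmem z).2 hz)
  have hlt : ∀ v, G.dist y v ≤ n → f v = f w → G.dist y v < n := by
    intro v hv hfv
    refine lt_of_le_of_ne hv fun heq => ?_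
    have := hcon v heq
    linarith
  -- If the claim fails, the maximisers avoid the sphere, so they lie in `S` and form a set closed
  -- under adjacency. Connectedness makes it all of `V`, contradicting `S ≠ V`.
  have hstep : ∀ u v, G.Adj u v → G.dist y u ≤ n ∧ f u = f w → G.dist y v ≤ n ∧ f v = f w := by
    rintro u v huv ⟨hu, hfu⟩
    have hu' := hlt u hu hfu
    have hnb : ∀ v, G.Adj u v → G.dist y v ≤ n := by
      intro v hv
      have : G.dist y v ≤ G.dist y u + 1 := by exact_mod_cast dist_adj_le hG hv y
      omega
    refine ⟨hnb v huv, ?_⟩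
    rw [← hfu]
    refine h.eq_of_forall_le (hS u hu') (fun v hv => ?_) huv
    rw [hfu]; exact hmax v ((hmem v).2 (hnb v hv))
  have hall : ∀ v, G.dist y v ≤ n ∧ f v = f w := by
    intro v
    obtain ⟨q⟩ := hG.preconnected w v
    have : ∀ a b : V, G.Walk a b → G.dist y a ≤ n ∧ f a = f w → G.dist y b ≤ n ∧ f b = f w := by
      intro a b q
      induction q with
      | nil => exact id
      | cons hadj _ ih => exact fun ha => ih (hstep _ _ hadj ha)
    exact this w v q ⟨(hmem w).1 hw, rfl⟩
  exact hne (Set.eq_univ_of_forall fun v => hS v (hlt v (hall v).1 (hall v).2))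

/-! ### Choice of a ball of small energy -/

/-- Pigeonhole over `N` spheres of radii `⌈s + 9 * t * i⌉`, all in `[s, 2 * s]` because `s = 9 * N *
t`. Rounding costs less than `1 ≤ t`, so the centres stay `8 * t` apart and the balls of radius `4 *
t` are disjoint. -/
theorem exists_small_energy_ball [G.LocallyFinite] (hG : G.Connected) {N : ℕ} (hN : 1 ≤ N)
    {s t : ℝ} (hst : s = 9 * N * t) (ht : 1 ≤ t) (y : V) (P : V → Prop)
    (hP : ∀ n : ℕ, s ≤ n → (n : ℝ) ≤ 2 * s → ∃ e, G.dist y e = n ∧ P e) :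
    ∃ e, (G.dist y e : ℝ) ≤ 2 * s ∧ P e ∧
      N * localEnergy G p f (ballFinset hG e (4 * t)) ≤
        localEnergy G p f (ballFinset hG y (4 * s)) := by
  have hN1 : (1 : ℝ) ≤ N := by exact_mod_cast hN
  have hs0 : 0 ≤ s := by rw [hst]; positivity
  have h4t : 4 * t ≤ 2 * s := by rw [hst]; nlinarith
  have hex : ∀ i : Fin N, ∃ e, G.dist y e = ⌈s + 9 * t * i⌉₊ ∧ P e := by
    intro i
    have hi0 : (0 : ℝ) ≤ (i : ℕ) := by positivity
    have hi : ((i : ℕ) : ℝ) + 1 ≤ N := by exact_mod_cast i.2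
    refine hP _ ((by nlinarith : s ≤ s + 9 * t * (i : ℕ)).trans (Nat.le_ceil _)) ?_
    have := (Nat.ceil_lt_add_one (by positivity : 0 ≤ s + 9 * t * (i : ℕ))).le
    nlinarith
  choose e he hPe using hex
  have hle : ∀ i : Fin N, s + 9 * t * (i : ℕ) ≤ G.dist y (e i) := fun i => by
    rw [he]; exact Nat.le_ceil _
  have hlt : ∀ i : Fin N, (G.dist y (e i) : ℝ) < s + 9 * t * (i : ℕ) + 1 := fun i => by
    rw [he]; exact Nat.ceil_lt_add_one (by positivity)
  have hle2 : ∀ i, (G.dist y (e i) : ℝ) ≤ 2 * s := fun i => by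
    have hi : ((i : ℕ) : ℝ) + 1 ≤ N := by exact_mod_cast i.2
    nlinarith [hlt i]
  have hdis : ∀ i j : Fin N, i < j →
      Disjoint (ballFinset hG (e i) (4 * t)) (ballFinset hG (e j) (4 * t)) := by
    intro i j hij
    refine ballFinset_disjoint hG ?_
    have h1 := dist_triangle_real hG y (e i) (e j)
    have h2 : ((i : ℕ) : ℝ) + 1 ≤ (j : ℕ) := by exact_mod_cast hij
    nlinarith [hlt i, hle j]
  have hsum := sum_localEnergy_le (G := G) (p := p) (f := f) Finset.univ
    (fun i => ballFinset hG (e i) (4 * t)) (ballFinset hG y (4 * s))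
    (fun i _ j _ hij => by
      rcases lt_or_gt_of_ne hij with h | h
      · exact hdis i j h
      · exact (hdis j i h).symm)
    (fun i _ => ballFinset_subset hG (by linarith [hle2 i]))
  have : Nonempty (Fin N) := ⟨⟨0, hN⟩⟩
  obtain ⟨i, -, hi⟩ := Finset.exists_min_image Finset.univ
    (fun i => localEnergy G p f (ballFinset hG (e i) (4 * t))) Finset.univ_nonempty
  refine ⟨e i, hle2 i, hPe i, le_trans ?_ hsum⟩
  have := Finset.card_nsmul_le_sum Finset.univ
    (fun i => localEnergy G p f (ballFinset hG (e i) (4 * t))) _ hi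
  simpa using this

end

section
variable {V : Type u} {G : SimpleGraph V} {p : ℝ} {f : V → ℝ}

/-! ### Energy estimates -/

theorem localEnergy_le_energy (T : Finset V) :
    ENNReal.ofReal (localEnergy G p f T) ≤ 2 * energy G p f := by
  classical
  set D := (T ×ˢ T).filter fun z => G.Adj z.1 z.2 with hD
  set I := D.image fun z => s(z.1, z.2) with hI
  have hmem : ∀ e ∈ I, e ∈ G.edgeSet := by
    intro e he
    obtain ⟨z, hz, rfl⟩ := Finset.mem_image.1 he
    exact (Finset.mem_filter.1 hz).2
  have h1 : ENNReal.ofReal (localEnergy G p f T) =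
      ∑ z ∈ D, edgeEnergy p f s(z.1, z.2) := by
    have : localEnergy G p f T = ∑ z ∈ D, |f z.1 - f z.2| ^ p := by
      rw [hD, Finset.sum_filter, Finset.sum_product]
      unfold localEnergy
      refine Finset.sum_congr rfl fun u _ => Finset.sum_congr rfl fun v _ => ?_
      congr
    rw [this, ENNReal.ofReal_sum_of_nonneg fun _ _ => by positivity]
    rfl
  have h2 : ∑ z ∈ D, edgeEnergy p f s(z.1, z.2) ≤ ∑ e ∈ I, 2 * edgeEnergy p f e := by
    rw [Finset.sum_comp (edgeEnergy p f) fun z : V × V => s(z.1, z.2)]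
    refine Finset.sum_le_sum fun e he => ?_
    obtain ⟨z, hz, rfl⟩ := Finset.mem_image.1 he
    rw [nsmul_eq_mul]
    gcongr
    have hsub : (D.filter fun a => s(a.1, a.2) = s(z.1, z.2)) ⊆ {z, z.swap} := by
      rintro ⟨a, b⟩ hab
      have := (Finset.mem_filter.1 hab).2
      obtain ⟨z1, z2⟩ := z
      simpa [Sym2.eq_iff] using this
    have := (Finset.card_le_card hsub).trans Finset.card_le_two
    exact_mod_cast this
  rw [h1]
  refine h2.trans ?_
  rw [← Finset.mul_sum]
  gcongr
  unfold energy
  rw [← Finset.sum_coe_sort]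
  have hinj : Function.Injective fun e : I => (⟨e.1, hmem e.1 e.2⟩ : G.edgeSet) :=
    fun a b hab => Subtype.ext (congrArg (fun z : G.edgeSet => (z : Sym2 V)) hab)
  calc ∑ e : I, edgeEnergy p f e.1
      = ∑' e : I, edgeEnergy p f e.1 := (tsum_fintype _).symm
    _ ≤ _ := ENNReal.tsum_comp_le_tsum_of_injective hinj
        fun e : G.edgeSet => edgeEnergy p f (e : Sym2 V)

/-- The logarithmic Caccioppoli inequality. -/
theorem log_caccioppoli [G.LocallyFinite] (hG : G.Connected) (hp : 1 < p) {h φ : V → ℝ}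
    (hpos : ∀ v, 0 < h v) {x : V} {r s : ℝ} (hrs : r ≤ s)
    (hh : IsPHarmonicOn G p h (ball G x s)) (hφ : ∀ v, 0 ≤ φ v)
    (hφ1 : ∀ v ∈ ball G x r, φ v = 1) (hφ0 : ∀ v, v ∉ ball G x s → φ v = 0) :
    (p - 1) / 2 * localEnergy G p (fun v => Real.log (h v)) (ballFinset hG x r) ≤
      2 ^ (p - 1) * localEnergy G p φ (ballFinset hG x (s + 1)) := by
  classical
  -- The extra `1` captures all neighbours of `B(x, s)`, so that at its vertices the inner sums are
  -- full Laplacians.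
  set T := ballFinset hG x (s + 1) with hT
  set F : V → V → ℝ := fun u v =>
    if G.Adj u v then Real.sign (h v - h u) * |h v - h u| ^ (p - 1) else 0 with hF
  set ψ : V → ℝ := fun u => φ u ^ p * h u ^ (1 - p) with hψ
  have hFneg : ∀ u v, F v u = -F u v := by
    intro u v
    simp only [hF, G.adj_comm v u]
    split_ifs with huv
    · rw [show h u - h v = -(h v - h u) by ring, Real.sign_neg, abs_neg]; ring
    · simp
  have hzero : ∑ u ∈ T, ∑ v ∈ T, F u v * ψ u = 0 := by
    refine Finset.sum_eq_zero fun u _ => ?_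
    by_cases hu : u ∈ ball G x s
    · rw [← Finset.sum_mul]
      have : ∑ v ∈ T, F u v = 0 := by
        rw [← hh.sum_eq_zero hu, hF, ← Finset.sum_filter]
        refine Finset.sum_congr ?_ fun _ _ => rfl
        ext v
        simp only [Finset.mem_filter, SimpleGraph.mem_neighborFinset, and_iff_right_iff_imp]
        intro huv
        rw [hT, mem_ballFinset]
        have hu' : (G.dist x u : ℝ) < s := hu
        linarith [dist_adj_le hG huv x]
      rw [this, zero_mul]
    · have : ψ u = 0 := by
        simp only [hψ]
        rw [hφ0 u hu, Real.zero_rpow (by linarith), zero_mul]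
      simp [this]
  have hzero' : ∑ u ∈ T, ∑ v ∈ T, F u v * ψ v = 0 := by
    rw [Finset.sum_comm, ← neg_eq_zero, ← Finset.sum_neg_distrib, ← hzero]
    refine Finset.sum_congr rfl fun u _ => ?_
    rw [← Finset.sum_neg_distrib]
    refine Finset.sum_congr rfl fun v _ => ?_
    rw [hFneg]; ring
  set Q : V → V → ℝ := fun u v => if G.Adj u v then
    min (φ u) (φ v) ^ p * |Real.log (h u) - Real.log (h v)| ^ p else 0 with hQ
  have hQ0 : ∀ u v, 0 ≤ Q u v := by
    intro u v
    simp only [hQ]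
    have := le_min (hφ u) (hφ v)
    split_ifs <;> positivity
  have hpt : ∀ u v, F u v * ψ v - F u v * ψ u ≤
      2 ^ (p - 1) * (if G.Adj u v then |φ u - φ v| ^ p else 0) - (p - 1) / 2 * Q u v := by
    intro u v
    simp only [hF, hQ, hψ]
    split_ifs
    · rw [← mul_sub]
      exact caccioppoli_pointwise hp (hpos u) (hpos v) (hφ u) (hφ v)
    · simp
  have hsum : 0 ≤ 2 ^ (p - 1) * localEnergy G p φ T - (p - 1) / 2 * ∑ u ∈ T, ∑ v ∈ T, Q u v := by
    calc (0 : ℝ) = ∑ u ∈ T, ∑ v ∈ T, (F u v * ψ v - F u v * ψ u) := by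
          simp only [Finset.sum_sub_distrib, hzero, hzero', sub_zero]
      _ ≤ ∑ u ∈ T, ∑ v ∈ T, (2 ^ (p - 1) * (if G.Adj u v then |φ u - φ v| ^ p else 0) -
          (p - 1) / 2 * Q u v) :=
        Finset.sum_le_sum fun u _ => Finset.sum_le_sum fun v _ => hpt u v
      _ = _ := by
        simp only [Finset.sum_sub_distrib, ← Finset.mul_sum]
        unfold localEnergy
        congr!
  have hle : localEnergy G p (fun v => Real.log (h v)) (ballFinset hG x r) ≤
      ∑ u ∈ T, ∑ v ∈ T, Q u v := by
    have hsub : ballFinset hG x r ⊆ T := by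
      refine ballFinset_subset hG ?_
      rw [SimpleGraph.dist_self]; push_cast; linarith
    calc localEnergy G p (fun v => Real.log (h v)) (ballFinset hG x r)
        = ∑ u ∈ ballFinset hG x r, ∑ v ∈ ballFinset hG x r, Q u v := by
          unfold localEnergy
          refine Finset.sum_congr rfl fun u hu => Finset.sum_congr rfl fun v hv => ?_
          rw [mem_ballFinset] at hu hv
          simp only [hQ, hφ1 u hu, hφ1 v hv, min_self, Real.one_rpow, one_mul]
      _ ≤ ∑ u ∈ ballFinset hG x r, ∑ v ∈ T, Q u v := Finset.sum_le_sum fun u _ =>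
          Finset.sum_le_sum_of_subset_of_nonneg hsub fun v _ _ => hQ0 u v
      _ ≤ _ := Finset.sum_le_sum_of_subset_of_nonneg hsub fun u _ _ =>
          Finset.sum_nonneg fun v _ => hQ0 u v
  have hq : 0 ≤ (p - 1) / 2 := by linarith
  linarith [mul_le_mul_of_nonneg_left hle hq]

theorem log_energy_le_of_capacity [G.LocallyFinite] (hG : G.Connected) (hp : 1 < p) {h : V → ℝ}
    (hpos : ∀ v, 0 < h v) {x : V} {r b : ℝ} (hr : 0 ≤ r) (hb : 0 < b)
    (hh : IsPHarmonicOn G p h (ball G x (2 * r)))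
    (hcap : capacity G p (ball G x r) (ball G x (2 * r))ᶜ ≤ ENNReal.ofReal b) :
    localEnergy G p (fun v => Real.log (h v)) (ballFinset hG x r) ≤
      2 ^ (p + 2) / (p - 1) * b := by
  have hlt : capacity G p (ball G x r) (ball G x (2 * r))ᶜ < ENNReal.ofReal (2 * b) :=
    hcap.trans_lt ((ENNReal.ofReal_lt_ofReal_iff (by positivity)).2 (by linarith))
  unfold capacity at hlt
  simp only [iInf_lt_iff] at hlt
  obtain ⟨g, ⟨hg0, hg1⟩, hg⟩ := hlt
  -- Swapping the boundary values and taking the absolute value gives a nonnegative cutoff without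
  -- raising the energy.
  set φ : V → ℝ := fun v => |1 - g v| with hφ
  have hen : energy G p φ ≤ energy G p g := by
    refine ENNReal.tsum_le_tsum fun e => ?_
    obtain ⟨e, he⟩ := e
    induction e with
    | _ u v =>
      simp only [edgeEnergy, Sym2.lift_mk]
      refine ENNReal.ofReal_le_ofReal (Real.rpow_le_rpow (abs_nonneg _) ?_ (by linarith))
      refine (abs_abs_sub_abs_le_abs_sub _ _).trans_eq ?_
      rw [abs_sub_comm]; congr 1; ring
  have h1 := log_caccioppoli hG hp hpos (r := r) (s := 2 * r) (by linarith) hh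
    (φ := φ) (fun v => abs_nonneg _) (fun v hv => by simp [hφ, hg0 v hv])
    (fun v hv => by simp [hφ, hg1 v hv])
  have h2 : localEnergy G p φ (ballFinset hG x (2 * r + 1)) ≤ 4 * b := by
    have h3 := (localEnergy_le_energy (G := G) (p := p) (f := φ)
      (ballFinset hG x (2 * r + 1))).trans (mul_le_mul_right (hen.trans hg.le) 2)
    rw [show (2 : ℝ≥0∞) = ENNReal.ofReal 2 by simp, ← ENNReal.ofReal_mul (by norm_num)] at h3
    have := (ENNReal.ofReal_le_ofReal_iff (by positivity)).1 h3
    linarith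
  have hp0 : 0 < p - 1 := by linarith
  have e : (2 : ℝ) ^ (p + 2) = 8 * 2 ^ (p - 1) := by
    rw [show p + 2 = (p - 1) + 3 by ring, Real.rpow_add (by norm_num)]; norm_num; ring
  have h4 : (0 : ℝ) < 2 ^ (p - 1) := by positivity
  rw [e, div_mul_eq_mul_div, le_div_iff₀ hp0]
  nlinarith [mul_le_mul_of_nonneg_left h2 h4.le]

/-! ### From modulus to energy -/

theorem sub_le_sum_of_isPath {g : V → ℝ} {T : Set V}
    (hg : ∀ u ∈ T, ∀ v ∈ T, G.Adj u v → |f u - f v| ≤ g u) (hg0 : ∀ u, 0 ≤ g u) {a b : V}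
    (q : G.Walk a b) (hq : ∀ v ∈ q.support, v ∈ T) : f a - f b ≤ (q.support.map g).sum := by
  induction q with
  | nil => simp [hg0]
  | @cons u v w hadj q ih =>
    have h1 := ih fun z hz => hq z (by simp [hz])
    have h2 := hg u (hq u (by simp)) v (hq v (by simp)) hadj
    simp only [SimpleGraph.Walk.support_cons, List.map_cons, List.sum_cons]
    linarith [le_abs_self (f u - f v)]

/-- A lower bound for the energy of a function separating two balls, from a lower bound for the
modulus. -/
theorem energy_ge_of_modulus [G.LocallyFinite] (hG : G.Connected) (hp : 0 < p) {y e₁ e₂ : V}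
    {r l b t τ : ℝ} (hl : 0 ≤ l) (hτ : 0 < τ) (ht : (G.dist y e₁ : ℝ) + r + l ≤ t)
    (hf : ∀ u ∈ ball G e₁ r, ∀ v ∈ ball G e₂ r, τ ≤ f u - f v)
    (hmod : ENNReal.ofReal b ≤ modulus p {θ ∈ pathsBetween G (ball G e₁ r) (ball G e₂ r) |
          setDiam G θ.verts ≤ ENNReal.ofReal l}) :
    b * τ ^ p ≤ localEnergy G p f (ballFinset hG y t) := by
  classical
  set T := ballFinset hG y t with hT
  set S : V → ℝ := fun u => if u ∈ T then
    ∑ v ∈ T, (if G.Adj u v then |f u - f v| ^ p else 0) else 0 with hS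
  have hS0 : ∀ u, 0 ≤ S u := by
    intro u
    simp only [hS]
    split_ifs
    · exact Finset.sum_nonneg fun v _ => by convert edge_term_nonneg (G := G) (p := p) u v
    · exact le_rfl
  set g : V → ℝ := fun u => S u ^ (1 / p) with hgdef
  have hg0 : ∀ u, 0 ≤ g u := fun u => Real.rpow_nonneg (hS0 u) _
  have hg : ∀ u ∈ (T : Set V), ∀ v ∈ (T : Set V), G.Adj u v → |f u - f v| ≤ g u := by
    intro u hu v hv huv
    have hu' : u ∈ T := hu
    have h1 : |f u - f v| ^ p ≤ S u := by
      simp only [hS, if_pos hu']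
      refine le_trans (by simp [huv]) (Finset.single_le_sum
        (f := fun w => if G.Adj u w then |f u - f w| ^ p else 0)
        (fun w _ => by convert edge_term_nonneg (G := G) (p := p) u w) hv)
    have h9 := Real.rpow_le_rpow (by positivity) h1 (one_div_pos.2 hp).le
    rwa [← Real.rpow_mul (abs_nonneg _), mul_one_div_cancel hp.ne', Real.rpow_one] at h9
  -- A discrete upper gradient scaled by `1 / τ`: it is admissible by telescoping, and its `p`-mass
  -- is the local energy over `τ ^ p`.
  set ρ : V → ℝ≥0 := fun u => Real.toNNReal (g u / τ) with hρ
  have hρc : ∀ u, (ρ u : ℝ) = g u / τ := fun u => Real.coe_toNNReal _ (div_nonneg (hg0 u) hτ.le)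
  have hadm : ρ ∈ Adm {θ ∈ pathsBetween G (ball G e₁ r) (ball G e₂ r) |
          setDiam G θ.verts ≤ ENNReal.ofReal l} := by
    change 1 ≤ ⨅ θ ∈ _, (rhoLength ρ θ : ℝ≥0∞)
    refine le_iInf₂ fun θ hθ => ?_
    obtain ⟨⟨hθ1, hθ2⟩, hd⟩ := hθ
    have hin : ∀ v ∈ θ.walk.support, v ∈ (T : Set V) := by
      intro v hv
      have h1 : (G.dist θ.first v : ℝ≥0∞) ≤ ENNReal.ofReal l :=
        le_trans (le_trans (le_iSup₂ (f := fun w (_ : w ∈ θ.verts) => (G.dist θ.first w : ℝ≥0∞))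
          v hv) (le_iSup₂ (f := fun z (_ : z ∈ θ.verts) => ⨆ w ∈ θ.verts, (G.dist z w : ℝ≥0∞))
          θ.first θ.walk.start_mem_support)) hd
      have h2 : (G.dist θ.first v : ℝ) ≤ l := by
        rw [← ENNReal.ofReal_natCast] at h1
        exact (ENNReal.ofReal_le_ofReal_iff hl).1 h1
      have h3 : (G.dist e₁ θ.first : ℝ) < r := hθ1
      have h4 := dist_triangle_real hG y e₁ v
      have h5 := dist_triangle_real hG e₁ θ.first v
      change v ∈ T
      rw [hT, mem_ballFinset]
      linarith
    -- The `ρ`-length counts each vertex once, so telescoping is done along a simple path inside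
    -- `θ`.
    have hsub : ∀ v ∈ θ.walk.bypass.support, v ∈ θ.walk.support :=
      fun v hv => θ.walk.support_bypass_subset_support hv
    have h1 := sub_le_sum_of_isPath hg hg0 θ.walk.bypass fun v hv => hin v (hsub v hv)
    rw [← List.sum_toFinset g θ.walk.bypass_isPath.support_nodup] at h1
    have h2 := hf _ hθ1 _ hθ2
    have h3 : ∑ v ∈ θ.walk.bypass.support.toFinset, g v ≤ ∑ v ∈ θ.walk.support.toFinset, g v :=
      Finset.sum_le_sum_of_subset_of_nonneg
        (fun v hv => by simpa using hsub v (by simpa using hv)) fun v _ _ => hg0 v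
    have h4 : (1 : ℝ) ≤ rhoLength ρ θ := by
      unfold rhoLength
      push_cast
      simp only [hρc, ← Finset.sum_div]
      rw [le_div_iff₀ hτ, one_mul]
      convert h2.trans (h1.trans h3)
    exact_mod_cast h4
  have hm : modulus p {θ ∈ pathsBetween G (ball G e₁ r) (ball G e₂ r) |
      setDiam G θ.verts ≤ ENNReal.ofReal l} ≤ ∑' v, (ρ v : ℝ≥0∞) ^ p := iInf₂_le ρ hadm
  have hterm : ∀ v, (ρ v : ℝ≥0∞) ^ p = ENNReal.ofReal (S v / τ ^ p) := by
    intro v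
    have h0 : (ρ v : ℝ≥0∞) = ENNReal.ofReal (g v / τ) := rfl
    rw [h0, ENNReal.ofReal_rpow_of_nonneg (div_nonneg (hg0 v) hτ.le) hp.le,
      Real.div_rpow (hg0 v) hτ.le]
    simp only [hgdef]
    rw [← Real.rpow_mul (hS0 v), one_div_mul_cancel hp.ne', Real.rpow_one]
  have hsum : ∑' v, (ρ v : ℝ≥0∞) ^ p = ENNReal.ofReal (localEnergy G p f T / τ ^ p) := by
    simp only [hterm]
    rw [tsum_eq_sum (s := T), ← ENNReal.ofReal_sum_of_nonneg, ← Finset.sum_div]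
    · congr 2
      unfold localEnergy
      refine Finset.sum_congr rfl fun u hu => ?_
      simp only [hS, if_pos hu]
    · exact fun v _ => div_nonneg (hS0 v) (by positivity)
    · intro v hv
      simp [hS, hv]
  rw [hsum] at hm
  have := (ENNReal.ofReal_le_ofReal_iff
    (div_nonneg (localEnergy_nonneg T) (by positivity))).1 (hmod.trans hm)
  rwa [le_div_iff₀ (by positivity)] at this

end
/-! ### Oscillation of functions satisfying the maximum principle -/

/-- The left side equals `9 * (1 / (9 * N)) ^ (1 - ζ)`, which tends to `0` exactly because `ζ < 1`.
-/
theorem exists_scale_ratio (p : ℝ) {ζ : ℝ} (hζ : ζ < 1) :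
    ∃ N : ℕ, 1 ≤ N ∧ (1 / N : ℝ) * (1 / (9 * N : ℝ)) ^ (-ζ) ≤ (1 / 4) ^ p := by
  set b : ℝ := ((1 / 4) ^ p / 9) ^ (1 / (1 - ζ)) with hb
  have hζ' : 0 < 1 - ζ := by linarith
  have hb0 : 0 < b := by positivity
  obtain ⟨N, hN⟩ := exists_nat_gt (max 1 (1 / b))
  have hN1 : (1 : ℝ) < N := (le_max_left _ _).trans_lt hN
  have hN2 : 1 / b < N := (le_max_right _ _).trans_lt hN
  have hN0 : (0 : ℝ) < N := by linarith
  refine ⟨N, by exact_mod_cast hN1.le, ?_⟩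
  have ha : (0 : ℝ) < 1 / (9 * N) := by positivity
  have hab : (1 : ℝ) / (9 * N) ≤ b := by
    rw [div_le_iff₀ (by positivity)]
    rw [div_lt_iff₀ hb0] at hN2
    nlinarith
  have h1 : (1 / N : ℝ) * (1 / (9 * N : ℝ)) ^ (-ζ) = 9 * (1 / (9 * N : ℝ)) ^ (1 - ζ) := by
    rw [sub_eq_add_neg, Real.rpow_add ha, Real.rpow_one]
    field_simp
  have h2 : (1 / (9 * N : ℝ)) ^ (1 - ζ) ≤ b ^ (1 - ζ) := Real.rpow_le_rpow ha.le hab hζ'.le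
  have h3 : b ^ (1 - ζ) = (1 / 4) ^ p / 9 := by
    rw [hb, ← Real.rpow_mul (by positivity), one_div_mul_cancel hζ'.ne', Real.rpow_one]
  rw [h1]
  linarith

theorem rpow_le_of_mem_Icc {a t ζ : ℝ} (ht1 : 1 ≤ t) (hta : t ≤ 1 / a) :
    t ^ ζ ≤ (1 / a) ^ |ζ| :=
  (Real.rpow_le_rpow_of_exponent_le ht1 (le_abs_self ζ)).trans
    (Real.rpow_le_rpow (by linarith) hta (abs_nonneg ζ))

/-- A function which satisfies the maximum and minimum principles, has small energy, and whose
energy controls its separation of balls, has bounded oscillation. -/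
theorem exists_osc_bound (p ζ : ℝ) (hp : 1 < p) (hζ : ζ < 1) (c L : ℝ → ℝ)
    (hc : ∀ κ, 0 < κ → 0 < c κ) (C₀ : ℝ) (hC₀ : 0 < C₀) :
    ∃ δ D : ℝ, 0 < δ ∧ δ < 1 ∧ 0 ≤ D ∧
      ∀ (V : Type u) (G : SimpleGraph V) [G.LocallyFinite] (hG : G.Connected) (f : V → ℝ) (x : V)
        (S : ℝ), 0 < S →
        (∀ (y : V) (n : ℕ) (z : V), (G.dist x y : ℝ) + n ≤ 8 * S → G.dist y z ≤ n →
          ∃ e, G.dist y e = n ∧ f z ≤ f e) →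
        (∀ (y : V) (n : ℕ) (z : V), (G.dist x y : ℝ) + n ≤ 8 * S → G.dist y z ≤ n →
          ∃ e, G.dist y e = n ∧ f e ≤ f z) →
        localEnergy G p f (ballFinset hG x (4 * S)) ≤ C₀ * S ^ ζ →
        (∀ κ, 0 < κ → ∀ (r : ℝ) (e₁ e₂ : V), 1 ≤ r → r ≤ S → (G.dist e₁ e₂ : ℝ) ≤ κ * r →
          ∀ (y : V) (t τ : ℝ), 0 < τ → (∀ u ∈ ball G e₁ r, ∀ v ∈ ball G e₂ r, τ ≤ f u - f v) →
            (G.dist y e₁ : ℝ) + r + L κ * r ≤ t →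
            c κ * r ^ ζ * τ ^ p ≤ localEnergy G p f (ballFinset hG y t)) →
        ∀ u ∈ ball G x (δ * S), ∀ v ∈ ball G x (δ * S), f u - f v ≤ D := by
  have hp0 : 0 < p := by linarith
  obtain ⟨N, hN, hNq⟩ := exists_scale_ratio p hζ
  have hN1 : (1 : ℝ) ≤ N := by exact_mod_cast hN
  set a : ℝ := 1 / (9 * N) with ha
  set q : ℝ := 1 / N with hq
  have ha0 : 0 < a := by positivity
  have ha9 : a ≤ 1 / 9 := by
    rw [ha]; exact one_div_le_one_div_of_le (by norm_num) (by linarith)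
  have hq0 : 0 < q := by positivity
  have hq1 : q ≤ 1 := by rw [hq, div_le_one (by linarith)]; exact hN1
  set Θ : ℝ := q * a ^ (-ζ) with hΘ
  have hΘ0 : 0 < Θ := by positivity
  have haζ : 0 < a ^ ζ := by positivity
  have hΘa : Θ * a ^ ζ = q := by
    rw [hΘ, mul_assoc, ← Real.rpow_add ha0]; simp
  set θ : ℝ := Θ ^ (1 / p) with hθ
  have hθ0 : 0 < θ := by positivity
  have hθ4 : θ ≤ 1 / 4 := by
    have := Real.rpow_le_rpow hΘ0.le hNq (one_div_pos.2 hp0).le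
    rwa [← Real.rpow_mul (by norm_num), mul_one_div_cancel hp0.ne', Real.rpow_one] at this
  have hθk : ∀ k : ℕ, (Θ ^ k) ^ (1 / p) = θ ^ k := by
    intro k
    rw [hθ, ← Real.rpow_natCast, ← Real.rpow_mul hΘ0.le, mul_comm, Real.rpow_mul hΘ0.le,
      Real.rpow_natCast]
  -- Two centres within `2 * s k` of `y` are within `4 * s k = κ * s (k + 1)` of each other.
  set κ : ℝ := 4 / a with hκ
  have hκ0 : 0 < κ := by positivity
  have hcκ := hc κ hκ0
  have h1a : 1 < 1 / a := by rw [lt_div_iff₀ ha0]; linarith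
  -- Going up `J` scales gives a ball large enough to contain the Loewner paths of scale `k + 1`.
  obtain ⟨J, hJ1, hJ⟩ : ∃ J, 1 ≤ J ∧ 3 + L κ ≤ (1 / a) ^ J := by
    obtain ⟨J, hJ⟩ := pow_unbounded_of_one_lt (3 + L κ) h1a
    exact ⟨J + 1, by omega, hJ.le.trans (pow_le_pow_right₀ h1a.le (Nat.le_succ _))⟩
  -- Dividing by `q ^ J` makes the energy hypotheses of the recursion true for all `i ≤ J` at its
  -- starting scale `J`.
  set C' : ℝ := C₀ / q ^ J with hC'
  have hC'0 : 0 < C' := by positivity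
  set B₁ : ℝ := C' / (c κ * Θ ^ J * (a ^ ζ) ^ (J + 1)) with hB₁
  have hB₁0 : 0 < B₁ := by positivity
  set D₁ : ℝ := B₁ ^ (1 / p) with hD₁
  set D₂ : ℝ := 2 * (1 / a) * (C' * (1 / a) ^ |ζ|) ^ (1 / p) with hD₂
  -- `D₂` handles the last scale above `1`. Half of `D` dominates the separation constant `D₁`; the
  -- other half absorbs the two oscillations of scale `k + 1`, since `2 * θ ≤ 1 / 2`.
  set D : ℝ := 2 * D₁ + D₂ with hD
  have hD₁0 : 0 < D₁ := by positivity
  have hD₂0 : 0 < D₂ := by positivity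
  have hD0 : 0 < D := by positivity
  clear_value D D₂ D₁ B₁ C' κ θ Θ q a
  refine ⟨a ^ J, D * θ ^ J, by positivity, pow_lt_one₀ ha0.le (by linarith) (by omega),
    by positivity, ?_⟩
  intro V G _ hG f x S hS hmax hmin hen hL
  set s : ℕ → ℝ := fun k => a ^ k * S with hs
  have hs0 : ∀ k, 0 < s k := fun k => by simp only [hs]; positivity
  have hss : ∀ k, s (k + 1) = a * s k := fun k => by simp only [hs]; ring
  have hsζ : ∀ k, s (k + 1) ^ ζ = a ^ ζ * s k ^ ζ := fun k => by
    rw [hss, Real.mul_rpow ha0.le (hs0 k).le]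
  have hsζ' : ∀ i k, s (k + i) ^ ζ = (a ^ ζ) ^ i * s k ^ ζ := by
    intro i k
    induction i with
    | zero => simp
    | succ i ih => rw [← add_assoc, hsζ, ih]; ring
  have hsle : ∀ k, s k ≤ S := fun k => by
    simp only [hs]
    exact mul_le_of_le_one_left hS.le (pow_le_one₀ ha0.le (by linarith))
  have hsJ : s J ≤ S / 9 := by
    have h1 : a ^ J ≤ a ^ 1 := pow_le_pow_of_le_one ha0.le (by linarith) hJ1
    have h2 := mul_le_mul_of_nonneg_right (h1.trans_eq (pow_one a)) hS.le
    have h3 := mul_le_mul_of_nonneg_right ha9 hS.le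
    simp only [hs]
    linarith
  -- `m` bounds the number of scales left before the radius is at most `1`. The margin `3 * s k` in
  -- the energy bounds pays for moving the centre: `2 * s k + 3 * s (k + 1) ≤ 3 * s k`. At `i = k`
  -- the radius is `4 * s k`, as in `exists_small_energy_ball`.
  have key : ∀ m k : ℕ, J ≤ k → a ^ m * s k ≤ 1 → ∀ y : V,
      (G.dist x y : ℝ) + 3 * s k ≤ 3 * s J →
      (∀ i ≤ k, localEnergy G p f (ballFinset hG y (s i + 3 * s k)) ≤ C' * Θ ^ i * s i ^ ζ) →
      ∀ u ∈ ball G y (s k), ∀ v ∈ ball G y (s k), f u - f v ≤ D * θ ^ k := by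
    intro m
    have htriv : ∀ k : ℕ, s k ≤ 1 → ∀ y : V, ∀ u ∈ ball G y (s k), ∀ v ∈ ball G y (s k),
        f u - f v ≤ D * θ ^ k := by
      intro k hk y u hu v hv
      have hz : ∀ w ∈ ball G y (s k), w = y := by
        intro w hw
        have hw' : (G.dist y w : ℝ) < s k := hw
        have : (G.dist y w : ℝ) < 1 := hw'.trans_le hk
        have : G.dist y w = 0 := by
          have : G.dist y w < 1 := by exact_mod_cast this
          omega
        exact ((hG.dist_eq_zero_iff).1 this).symm
      rw [hz u hu, hz v hv, sub_self]
      positivity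
    induction m with
    | zero => exact fun k _ hk y _ _ => htriv k (by simpa using hk) y
    | succ m ih =>
      intro k hJk hk y hy hI u hu v hv
      rcases le_or_gt (s k) 1 with hk1 | hk1
      · exact htriv k hk1 y u hu v hv
      rcases lt_or_ge (s (k + 1)) 1 with hk2 | hk2
      -- The next radius would be below `1`, too small for the Loewner condition. But `s k ≤ 1 / a`
      -- is bounded, so summing edge differences along geodesics suffices.
      · have hka : s k ≤ 1 / a := by
          rw [le_div_iff₀ ha0, mul_comm, ← hss]; exact hk2.le
        set E := localEnergy G p f (ballFinset hG y (s k + 3 * s k)) with hE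
        have hE0 : 0 ≤ E := localEnergy_nonneg _
        have hEb : E ^ (1 / p) ≤ (C' * (1 / a) ^ |ζ|) ^ (1 / p) * θ ^ k := by
          rw [← hθk, ← Real.mul_rpow (by positivity) (by positivity)]
          refine Real.rpow_le_rpow hE0 ((hI k le_rfl).trans ?_) (one_div_pos.2 hp0).le
          have := rpow_le_of_mem_Icc (ζ := ζ) hk1.le hka
          calc C' * Θ ^ k * s k ^ ζ ≤ C' * Θ ^ k * (1 / a) ^ |ζ| := by gcongr
            _ = _ := by ring
        have hosc : ∀ w ∈ ball G y (s k), |f w - f y| ≤ 1 / a * E ^ (1 / p) := by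
          intro w hw
          have hw' : (G.dist y w : ℝ) < s k := hw
          refine (abs_sub_le_dist_mul hG hp0 (r := s k + 3 * s k) w
            (by linarith [hs0 k])).trans ?_
          exact mul_le_mul_of_nonneg_right (by linarith) (Real.rpow_nonneg hE0 _)
        have h1 := (abs_le.1 (hosc u hu)).2
        have h2 := (abs_le.1 (hosc v hv)).1
        calc f u - f v ≤ 2 * (1 / a) * E ^ (1 / p) := by linarith
          _ ≤ 2 * (1 / a) * ((C' * (1 / a) ^ |ζ|) ^ (1 / p) * θ ^ k) := by gcongr
          _ = D₂ * θ ^ k := by rw [hD₂]; ring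
          _ ≤ D * θ ^ k := by
            refine mul_le_mul_of_nonneg_right ?_ (by positivity)
            rw [hD]; linarith
      · have hsk : s k = 9 * N * s (k + 1) := by
          rw [hss, ha]; field_simp
        have hregion : ∀ n : ℕ, (n : ℝ) ≤ 2 * s k → (G.dist x y : ℝ) + n ≤ 8 * S := by
          intro n hn; linarith [hs0 k]
        have hnext : ∀ e, (G.dist y e : ℝ) ≤ 2 * s k →
            N * localEnergy G p f (ballFinset hG e (4 * s (k + 1))) ≤
              localEnergy G p f (ballFinset hG y (4 * s k)) →
            ∀ u ∈ ball G e (s (k + 1)), ∀ v ∈ ball G e (s (k + 1)),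
              f u - f v ≤ D * θ ^ (k + 1) := by
          intro e he hNe
          have h3a : 3 * s (k + 1) ≤ s k := by
            rw [hss]; linarith [mul_le_mul_of_nonneg_right ha9 (hs0 k).le, hs0 k]
          refine ih (k + 1) (by omega) (le_trans (le_of_eq (by rw [hss]; ring)) hk) e ?_ ?_
          · linarith [dist_triangle_real hG x y e]
          · intro i hi
            rcases Nat.lt_or_ge i (k + 1) with hi' | hi'
            · refine (localEnergy_mono (ballFinset_subset hG ?_)).trans (hI i (by omega))
              linarith
            · obtain rfl : i = k + 1 := by omega
              have h1 := hI k le_rfl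
              rw [show s k + 3 * s k = 4 * s k by ring] at h1
              rw [show s (k + 1) + 3 * s (k + 1) = 4 * s (k + 1) by ring]
              have h2 : C' * Θ ^ (k + 1) * s (k + 1) ^ ζ = q * (C' * Θ ^ k * s k ^ ζ) := by
                rw [hsζ, ← hΘa]; ring
              rw [h2, hq, one_div, ← div_eq_inv_mul, le_div_iff₀ (by linarith), mul_comm]
              exact hNe.trans h1
        have hdist : ∀ w ∈ ball G y (s k), ∀ n : ℕ, s k ≤ n → G.dist y w ≤ n := by
          intro w hw n hn
          have hw' : (G.dist y w : ℝ) < s k := hw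
          exact_mod_cast hw'.le.trans hn
        obtain ⟨e₁, he₁, hf₁, hN₁⟩ := exists_small_energy_ball (p := p) (f := f) hG hN hsk hk2 y
          (fun e => f u ≤ f e) fun n hn hn' => hmax y n u (hregion n hn') (hdist u hu n hn)
        obtain ⟨e₂, he₂, hf₂, hN₂⟩ := exists_small_energy_ball (p := p) (f := f) hG hN hsk hk2 y
          (fun e => f e ≤ f v) fun n hn hn' => hmin y n v (hregion n hn') (hdist v hv n hn)
        have ho₁ := hnext e₁ he₁ hN₁
        have ho₂ := hnext e₂ he₂ hN₂
        have hcen : ∀ e : V, e ∈ ball G e (s (k + 1)) := fun e => by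
          change (G.dist e e : ℝ) < _
          rw [SimpleGraph.dist_self]; exact_mod_cast hs0 _
        -- Guaranteed separation of the two small balls: `f` is at least `f u - D * θ ^ (k + 1)` on
        -- the first and at most `f v + D * θ ^ (k + 1)` on the second.
        set τ := f u - f v - 2 * (D * θ ^ (k + 1)) with hτ
        have hfin : τ ≤ D₁ * θ ^ k → f u - f v ≤ D * θ ^ k := by
          intro h
          have h1 : 2 * (D * θ ^ (k + 1)) ≤ D / 2 * θ ^ k := by
            rw [pow_succ]
            have : 0 < D * θ ^ k := by positivity
            linarith [mul_le_mul_of_nonneg_left hθ4 this.le]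
          have h2 : D₁ * θ ^ k ≤ D / 2 * θ ^ k :=
            mul_le_mul_of_nonneg_right (by rw [hD]; linarith) (by positivity)
          linarith
        apply hfin
        rcases le_or_gt τ 0 with hτ0 | hτ0
        · exact hτ0.trans (by positivity)
        have hd12 : (G.dist e₁ e₂ : ℝ) ≤ κ * s (k + 1) := by
          have h1 := dist_triangle_real hG e₁ y e₂
          rw [SimpleGraph.dist_comm (u := e₁) (v := y)] at h1
          have h2 : κ * s (k + 1) = 4 * s k := by rw [hκ, hss]; field_simp
          linarith
        obtain ⟨j, rfl⟩ : ∃ j, k = j + J := ⟨k - J, by omega⟩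
        have hsjJ : s j = (1 / a) ^ J * s (j + J) := by
          simp only [hs]
          rw [pow_add, one_div, inv_pow]
          field_simp
        have hrad : (G.dist y e₁ : ℝ) + s (j + J + 1) + L κ * s (j + J + 1) ≤
            s j + 3 * s (j + J) := by
          have h1 : (3 + L κ) * s (j + J) ≤ s j := by
            rw [hsjJ]; exact mul_le_mul_of_nonneg_right hJ (hs0 _).le
          have h2 : s (j + J + 1) ≤ s (j + J) := by
            rw [hss]; exact mul_le_of_le_one_left (hs0 _).le (by linarith)
          -- No sign of `L κ` is assumed here.
          rcases le_or_gt 0 (L κ) with hLκ | hLκ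
          · linarith [mul_le_mul_of_nonneg_left h2 hLκ, hs0 (j + J)]
          · have h3 := mul_nonpos_of_nonpos_of_nonneg hLκ.le (hs0 (j + J + 1)).le
            linarith [hs0 j]
        have hmain := hL κ hκ0 (s (j + J + 1)) e₁ e₂ hk2 (hsle _) hd12 y _ τ hτ0
          (fun u' hu' v' hv' => by
            have h1 := ho₁ e₁ (hcen e₁) u' hu'
            have h2 := ho₂ v' hv' e₂ (hcen e₂)
            rw [hτ]; linarith) hrad
        have hmain' := hmain.trans (hI j (by omega))
        have hτp : τ ^ p ≤ B₁ * Θ ^ (j + J) := by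
          rw [show j + J + 1 = j + (J + 1) by ring, hsζ'] at hmain'
          have h1 := Real.rpow_pos_of_pos (hs0 j) ζ
          rw [hB₁, pow_add Θ j J, div_mul_eq_mul_div, le_div_iff₀ (by positivity)]
          refine le_of_mul_le_mul_right (a := s j ^ ζ) ?_ h1
          calc τ ^ p * (c κ * Θ ^ J * (a ^ ζ) ^ (J + 1)) * s j ^ ζ
              = c κ * ((a ^ ζ) ^ (J + 1) * s j ^ ζ) * τ ^ p * Θ ^ J := by ring
            _ ≤ C' * Θ ^ j * s j ^ ζ * Θ ^ J := by gcongr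
            _ = _ := by ring
        have := Real.rpow_le_rpow (by positivity) hτp (one_div_pos.2 hp0).le
        rwa [← Real.rpow_mul hτ0.le, mul_one_div_cancel hp0.ne', Real.rpow_one,
          Real.mul_rpow hB₁0.le (by positivity), hθk, ← hD₁] at this
  obtain ⟨m, hm⟩ : ∃ m : ℕ, a ^ m * s J ≤ 1 := by
    obtain ⟨m, hm⟩ := exists_pow_lt_of_lt_one (one_div_pos.2 (hs0 J)) (by linarith : a < 1)
    exact ⟨m, ((lt_div_iff₀ (hs0 J)).1 hm).le⟩
  refine key m J le_rfl hm x (by simp) ?_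
  intro i hi
  refine (localEnergy_mono (ballFinset_subset hG (s := 4 * S) ?_)).trans (hen.trans ?_)
  · rw [SimpleGraph.dist_self]; push_cast; linarith [hsle i]
  · have h1 := hsζ' i 0
    have h2 : s 0 = S := by simp [hs]
    rw [zero_add, h2] at h1
    have h3 : C' * Θ ^ i * ((a ^ ζ) ^ i * S ^ ζ) = C₀ * S ^ ζ * (q ^ i / q ^ J) := by
      have h4 : Θ ^ i * (a ^ ζ) ^ i = q ^ i := by rw [← mul_pow, hΘa]
      rw [hC']
      linear_combination C₀ / q ^ J * S ^ ζ * h4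
    rw [h1, h3]
    refine le_mul_of_one_le_right (by positivity) ?_
    rw [one_le_div (by positivity)]
    exact pow_le_pow_of_le_one hq0.le hq1 hi

/-! ### The Harnack inequality -/

theorem ofReal_le_graphDiam {V : Type u} {G : SimpleGraph V} {x : V} {R : ℝ}
    (hne : ball G x R ≠ Set.univ) : ENNReal.ofReal R ≤ graphDiam G := by
  obtain ⟨w, hw⟩ := (Set.ne_univ_iff_exists_notMem _).1 hne
  have h1 : R ≤ G.dist x w := not_lt.1 hw
  calc ENNReal.ofReal R ≤ ENNReal.ofReal (G.dist x w) := ENNReal.ofReal_le_ofReal h1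
    _ = (G.dist x w : ℝ≥0∞) := ENNReal.ofReal_natCast _
    _ ≤ ⨆ y ∈ (Set.univ : Set V), (G.dist x y : ℝ≥0∞) :=
        le_iSup₂ (f := fun y (_ : y ∈ (Set.univ : Set V)) => (G.dist x y : ℝ≥0∞)) w trivial
    _ ≤ graphDiam G := le_iSup₂ (f := fun z (_ : z ∈ (Set.univ : Set V)) =>
        ⨆ y ∈ (Set.univ : Set V), (G.dist z y : ℝ≥0∞)) x trivial

theorem ofReal_lt_graphDiam_div {V : Type u} {G : SimpleGraph V} {x : V} {R A r : ℝ}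
    (hne : ball G x R ≠ Set.univ) (hR : 0 < R) (hA : 0 < A) (hr : r < R / A) :
    ENNReal.ofReal r < graphDiam G / ENNReal.ofReal A :=
  calc ENNReal.ofReal r < ENNReal.ofReal (R / A) :=
        (ENNReal.ofReal_lt_ofReal_iff (by positivity)).2 hr
    _ = ENNReal.ofReal R / ENNReal.ofReal A := ENNReal.ofReal_div_of_pos hA
    _ ≤ _ := ENNReal.div_le_div_right (ofReal_le_graphDiam hne) _

theorem setDist_ball_le {V : Type u} {G : SimpleGraph V} {e₁ e₂ : V} {r b : ℝ} (hr : 0 < r)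
    (h : (G.dist e₁ e₂ : ℝ) ≤ b) :
    setDist G (ball G e₁ r) (ball G e₂ r) ≤ ENNReal.ofReal b := by
  have hc : ∀ e : V, e ∈ ball G e r := fun e => by
    change (G.dist e e : ℝ) < r
    rw [SimpleGraph.dist_self]; exact_mod_cast hr
  calc setDist G (ball G e₁ r) (ball G e₂ r) ≤ ⨅ y ∈ ball G e₂ r, (G.dist e₁ y : ℝ≥0∞) :=
        iInf₂_le (f := fun z (_ : z ∈ ball G e₁ r) =>
          ⨅ y ∈ ball G e₂ r, (G.dist z y : ℝ≥0∞)) e₁ (hc e₁)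
    _ ≤ (G.dist e₁ e₂ : ℝ≥0∞) :=
        iInf₂_le (f := fun z (_ : z ∈ ball G e₂ r) => (G.dist e₁ z : ℝ≥0∞)) e₂ (hc e₂)
    _ = ENNReal.ofReal (G.dist e₁ e₂) := (ENNReal.ofReal_natCast _).symm
    _ ≤ _ := ENNReal.ofReal_le_ofReal h

/-- Positive harmonic functions have logarithms of energy `O(R ^ (df - β))` on balls. -/
theorem log_energy_le {V : Type u} {G : SimpleGraph V} [G.LocallyFinite]
    (hG : G.Connected) {p df β CAR Ccap Acap : ℝ} (hp : 1 < p)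
    (hAR : AhlforsRegularWith G df CAR) (hcap : CapacityUpperWith G p β Ccap Acap)
    {x : V} {R r : ℝ} (hne : ball G x R ≠ Set.univ) (hr : 1 < r) (hrR : 2 * r ≤ R)
    (hrA : r < R / Acap) {h : V → ℝ} (hpos : ∀ v, 0 < h v)
    (hh : IsPHarmonicOn G p h (ball G x R)) :
    localEnergy G p (fun v => Real.log (h v)) (ballFinset hG x r) ≤
      2 ^ (p + 2) / (p - 1) * (Ccap * CAR * r ^ (df - β)) := by
  obtain ⟨hC1, hAR⟩ := hAR
  obtain ⟨hCc, hA, hcap⟩ := hcap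
  have hr0 : 0 < r := by linarith
  have hdiam : ENNReal.ofReal r < graphDiam G :=
    ((ENNReal.ofReal_lt_ofReal_iff (by linarith)).2 (by linarith : r < R)).trans_le
      (ofReal_le_graphDiam hne)
  refine log_energy_le_of_capacity hG hp hpos hr0.le (by positivity) ?_ ?_
  · intro v hv
    exact hh v (lt_of_lt_of_le (show (G.dist x v : ℝ) < 2 * r from hv) hrR)
  · refine (hcap x r hr.le
      (ofReal_lt_graphDiam_div hne (by linarith) (by linarith) hrA)).trans
      (ENNReal.ofReal_le_ofReal ?_)
    have h1 := (hAR x r hr hdiam).2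
    have h2 : 0 < r ^ β := by positivity
    rw [mul_assoc]
    refine mul_le_mul_of_nonneg_left ?_ hCc.le
    rw [div_le_iff₀ h2, mul_assoc, ← Real.rpow_add hr0]
    simpa using h1

theorem harnack_of_conditions (p df β : ℝ) (hp : 1 < p) (hζ : df - β < 1)
    (CAR ABCL : ℝ) (cBCL LBCL : ℝ → ℝ) (Ccap Acap : ℝ) (hCAR : 1 ≤ CAR) (hABCL : 1 ≤ ABCL)
    (hCcap : 0 < Ccap) (hAcap : 1 ≤ Acap) (hcL : ∀ κ, 0 < κ → 0 < cBCL κ ∧ 0 < LBCL κ) :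
    ∃ δH CH : ℝ, 0 < δH ∧ δH < 1 ∧ 1 ≤ CH ∧
      ∀ (V : Type u) (G : SimpleGraph V) [G.LocallyFinite],
        G.Connected →
        AhlforsRegularWith G df CAR →
        BallLoewnerWith G p (df - β) ABCL cBCL LBCL →
        CapacityUpperWith G p β Ccap Acap →
        ∀ (x : V) (R : ℝ), 1 ≤ R → ball G x R ≠ Set.univ →
          ∀ h : V → ℝ, (∀ v, 0 ≤ h v) → IsPHarmonicOn G p h (ball G x R) →
            ∀ u ∈ ball G x (δH * R), ∀ v ∈ ball G x (δH * R), h u ≤ CH * h v := by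
  have hp1 : 0 < p - 1 := by linarith
  obtain ⟨δ, D, hδ0, hδ1, hD, hosc⟩ := exists_osc_bound.{u} p (df - β) hp hζ cBCL LBCL
    (fun κ hκ => (hcL κ hκ).1) (2 ^ (p + 2) / (p - 1) * (Ccap * CAR * 4 ^ (df - β)))
    (by positivity)
  have hA0 : 0 < Acap := by linarith
  have hB0 : 0 < ABCL := by linarith
  have hAB : 1 ≤ Acap * ABCL := one_le_mul_of_one_le_of_one_le hAcap hABCL
  refine ⟨δ / (8 * (Acap * ABCL)), Real.exp D, by positivity, ?_, Real.one_le_exp hD, ?_⟩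
  · rw [div_lt_one (by positivity)]; linarith
  intro V G _ hG hAR hBL hcap x R hR hne h h0 hh u hu v hv
  -- Small enough that `8 * S ≤ R` keeps all spheres in the harmonic region, and radii up to `4 * S`
  -- are admissible in both the capacity and the Loewner conditions.
  set S := R / (8 * (Acap * ABCL)) with hS
  have hR0 : 0 < R := by linarith
  have hS0 : 0 < S := by positivity
  rw [show δ / (8 * (Acap * ABCL)) * R = δ * S by rw [hS]; ring] at hu hv
  have hRS : R = 8 * S * (Acap * ABCL) := by rw [hS]; field_simp
  have h8S : 8 * S ≤ R := by rw [hRS]; nlinarith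
  rcases le_or_gt (δ * S) 1 with hsmall | hbig
  · have hz : ∀ w ∈ ball G x (δ * S), w = x := by
      intro w hw
      have hw' : (G.dist x w : ℝ) < 1 := lt_of_lt_of_le hw hsmall
      have : G.dist x w = 0 := by
        have : G.dist x w < 1 := by exact_mod_cast hw'
        omega
      exact ((hG.dist_eq_zero_iff).1 this).symm
    rw [hz u hu, hz v hv]
    exact le_mul_of_one_le_left (h0 x) (Real.one_le_exp hD)
  have hS1 : 1 < S := by nlinarith
  have hrA : ∀ r, r ≤ 4 * S → r < R / Acap ∧ r < R / ABCL := by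
    intro r hr
    rw [lt_div_iff₀ hA0, lt_div_iff₀ hB0, hRS]
    have h1 : r * Acap ≤ 4 * S * Acap := mul_le_mul_of_nonneg_right hr hA0.le
    have h2 : r * ABCL ≤ 4 * S * ABCL := mul_le_mul_of_nonneg_right hr hB0.le
    have h3 : S * Acap ≤ S * (Acap * ABCL) :=
      mul_le_mul_of_nonneg_left (le_mul_of_one_le_right hA0.le hABCL) hS0.le
    have h4 : S * ABCL ≤ S * (Acap * ABCL) :=
      mul_le_mul_of_nonneg_left (le_mul_of_one_le_left hB0.le hAcap) hS0.le
    have h5 : 0 < S * (Acap * ABCL) := by positivity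
    constructor <;> linarith
  -- Since `h` may vanish, the logarithm is taken of `h + ε`, which is still harmonic; `D` does not
  -- depend on `ε`, so `ε` can tend to `0`.
  have hpert : ∀ ε : ℝ, 0 < ε → h u + ε ≤ Real.exp D * (h v + ε) := by
    intro ε hε
    have hpos : ∀ w, 0 < h w + ε := fun w => by linarith [h0 w]
    have hhε := hh.add_const ε
    have hreg : ∀ (y : V) (n : ℕ), (G.dist x y : ℝ) + n ≤ 8 * S →
        ∀ w, G.dist y w < n → w ∈ ball G x R := by
      intro y n hn w hw
      have hw' : (G.dist y w : ℝ) < n := by exact_mod_cast hw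
      change (G.dist x w : ℝ) < R
      linarith [dist_triangle_real hG x y w]
    have key := hosc V G hG (fun w => Real.log (h w + ε)) x S hS0
      (fun y n z hn hz => by
        obtain ⟨e, he, hle⟩ := hhε.exists_sphere_ge hG y n (hreg y n hn) hne hz
        exact ⟨e, he, Real.log_le_log (hpos z) hle⟩)
      (fun y n z hn hz => by
        obtain ⟨e, he, hle⟩ := hhε.neg.exists_sphere_ge hG y n (hreg y n hn) hne hz
        exact ⟨e, he, Real.log_le_log (hpos e) (neg_le_neg_iff.1 hle)⟩)
      (by
        have := log_energy_le hG hp hAR hcap hne (r := 4 * S) (by linarith) (by linarith)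
          (hrA _ le_rfl).1 hpos hhε
        rw [Real.mul_rpow (by norm_num) hS0.le] at this
        refine this.trans (le_of_eq (by ring)))
      (fun κ hκ r e₁ e₂ hr hrS hd y t τ hτ hsep ht => by
        refine energy_ge_of_modulus hG (by linarith) (l := LBCL κ * r)
          (mul_nonneg (hcL κ hκ).2.le (by linarith)) hτ ht hsep ?_
        exact (hBL.2 κ hκ).2.2 r e₁ e₂ hr
          (ofReal_lt_graphDiam_div hne hR0 hB0 (hrA r (by linarith)).2)
          (setDist_ball_le (by linarith) hd))
      u hu v hv
    have h1 : Real.log (h u + ε) ≤ D + Real.log (h v + ε) := by linarith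
    have h2 := Real.exp_le_exp.2 h1
    rwa [Real.exp_add, Real.exp_log (hpos u), Real.exp_log (hpos v)] at h2
  refine le_of_forall_pos_le_add fun η hη => ?_
  have hE := Real.exp_pos D
  have h1 := hpert (η / Real.exp D) (by positivity)
  rw [mul_add, mul_div_cancel₀ _ hE.ne'] at h1
  have : 0 < η / Real.exp D := by positivity
  linarith

end GraphEHI

theorem theorem5p2 (p df β : ℝ) (hp : 1 < p) (hdf : 1 ≤ df) (hβ : 0 < β)
    (CAR ABCL : ℝ) (cBCL LBCL : ℝ → ℝ) (Ccap Acap : ℝ) :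
    ∃ δH CH : ℝ, 0 < δH ∧ δH < 1 ∧ 1 ≤ CH ∧
      ∀ (V : Type u) (G : SimpleGraph V) [G.LocallyFinite],
        G.Connected →
        (∃ D : ℕ, ∀ x : V, G.degree x ≤ D) →
        GraphEHI.AhlforsRegularWith G df CAR →
        GraphEHI.LowBallLoewnerWith G p (df - β) ABCL cBCL LBCL →
        GraphEHI.CapacityUpperWith G p β Ccap Acap →
        ∀ (x : V) (R : ℝ), 1 ≤ R → GraphEHI.ball G x R ≠ Set.univ →
          ∀ h : V → ℝ, (∀ v, 0 ≤ h v) →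
            GraphEHI.IsPHarmonicOn G p h (GraphEHI.ball G x R) →
            ∃ M m : ℝ,
              IsGreatest (h '' GraphEHI.ball G x (δH * R)) M ∧
              IsLeast (h '' GraphEHI.ball G x (δH * R)) m ∧
              M ≤ CH * m := by
  by_cases hgood : df - β < 1 ∧ 1 ≤ CAR ∧ 1 ≤ ABCL ∧ 0 < Ccap ∧ 1 ≤ Acap ∧
      ∀ κ, 0 < κ → 0 < cBCL κ ∧ 0 < LBCL κ
  · obtain ⟨hζ, hCAR, hABCL, hCcap, hAcap, hcL⟩ := hgood
    obtain ⟨δH, CH, hδ0, hδ1, hCH, H⟩ := GraphEHI.harnack_of_conditions.{u} p df β hp hζ CAR ABCL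
      cBCL LBCL Ccap Acap hCAR hABCL hCcap hAcap hcL
    refine ⟨δH, CH, hδ0, hδ1, hCH, ?_⟩
    intro V G _ hG _ hAR hBL hcap x R hR hne h h0 hh
    have hle := H V G hG hAR hBL.1 hcap x R hR hne h h0 hh
    have hfin := GraphEHI.ball_finite G hG x (δH * R)
    have hx : (GraphEHI.ball G x (δH * R)).Nonempty := by
      refine ⟨x, ?_⟩
      change (G.dist x x : ℝ) < _
      rw [SimpleGraph.dist_self]
      push_cast
      exact mul_pos hδ0 (by linarith)
    obtain ⟨u, hu, hmax⟩ := Set.exists_max_image _ h hfin hx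
    obtain ⟨v, hv, hmin⟩ := Set.exists_min_image _ h hfin hx
    refine ⟨h u, h v, ⟨⟨u, hu, rfl⟩, ?_⟩, ⟨⟨v, hv, rfl⟩, ?_⟩, hle u hu v hv⟩
    · rintro _ ⟨w, hw, rfl⟩; exact hmax w hw
    · rintro _ ⟨w, hw, rfl⟩; exact hmin w hw
  -- For inadmissible constants no graph satisfies the conditions, and any `δH`, `CH` in range will
  -- do.
  · refine ⟨1 / 2, 1, by norm_num, by norm_num, le_rfl, ?_⟩
    intro V G _ _ _ hAR hBL hcap
    exact absurd ⟨hBL.2.2, hAR.1, hBL.1.1, hcap.1, hcap.2.1,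
      fun κ hκ => ⟨(hBL.1.2 κ hκ).1, (hBL.1.2 κ hκ).2.1⟩⟩ hgood
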